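/- **Notation.** All spaces are complex Hilbert spaces. For a contraction $T$ put $D_T=(I-T^*T)^{1/2}$ and $\mathfrak D_T=\overline{\mathrm{ran}}\,D_T$. A *choice sequence* $\{\Gamma_n\}_{n\ge0}$ consists of contractions $\Gamma_0:\mathfrak M\to\mathfrak N$ and $\Gamma_n:\mathfrak D_{\Gamma_{n-1}}\to\mathfrak D_{\Gamma_{n-1}^*}$, $n\ge1$ (isometric, co-isometric and unitary $\Gamma_n$ are allowed; defect spaces may be $\{0\}$). With $\mathfrak D_{\Gamma_{-1}}=\mathfrak M$, $\mathfrak D_{\Gamma^*_{-1}}=\mathfrak N$ let $$\mathbf J_{\Gamma_n}=\begin{bmatrix}\Gamma_n&D_{\Gamma_n^*}\\ D_{\Gamma_n}&-\Gamma_n^*\end{bmatrix}:\mathfrak D_{\Gamma_{n-1}}\oplus\mathfrak D_{\Gamma_n^*}\to\mathfrak D_{\Gamma_{n-1}^*}\oplus\mathfrak D_{\Gamma_n},$$ $$\mathfrak H_0=\bigoplus_{n\ge0}(\mathfrak D_{\Gamma_{2n}}\oplus\mathfrak D_{\Gamma_{2n+1}^*}),\qquad \widetilde{\mathfrak H}_0=\bigoplus_{n\ge0}(\mathfrak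 D_{\Gamma_{2n}^*}\oplus\mathfrak D_{\Gamma_{2n+1}}),$$ $$\mathcal V_0=\bigoplus_{n\ge0}\mathbf J_{\Gamma_{2n+1}}:\mathfrak H_0\to\widetilde{\mathfrak H}_0,\qquad \mathcal L_0=\bigoplus_{n\ge0}\mathbf J_{\Gamma_{2n}}:\mathfrak M\oplus\widetilde{\mathfrak H}_0\to\mathfrak N\oplus\mathfrak H_0,$$ and let $\mathcal U_0=\mathcal L_0(I_{\mathfrak M}\oplus\mathcal V_0)$, $\widetilde{\mathcal U}_0=(I_{\mathfrak N}\oplus\mathcal V_0)\mathcal L_0$ be the block operator CMV matrices. Let $\zeta_0$, $\widetilde\zeta_0$ be the linear systems with input space $\mathfrak M$, output space $\mathfrak N$, state spaces $\mathfrak H_0$, $\widetilde{\mathfrak H}_0$ and block operators $\mathcal U_0$, $\widetilde{\mathcal U}_0$. Let $\mathcal T_0=P_{\mathfrak H_0}\mathcal U_0{\upharpoonright}\mathfrak H_0$ and $\widetilde{\mathcal T}_0=P_{\widetilde{\mathfrak H}_0}\widetilde{\mathcal U}_0{\upharpoonright}\widetilde{\mathfrak H}_0$. A system $\tau=\begin{bmatrix}D&C\\B&A\end{bmatrix}:\mathfrak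 M\oplus\mathfrak H\to\mathfrak N\oplus\mathfrak H$ is *conservative* if this operator is unitary, and *simple* if $\mathfrak H=\overline{\mathrm{span}}\{A^kB\mathfrak M,\,A^{*l}C^*\mathfrak N:k,l\ge0\}$. Its transfer function is $\Theta_\tau(\lambda)=D+\lambda C(I-\lambda A)^{-1}B$, $|\lambda|<1$. Two systems with the same input and output spaces are *unitarily equivalent* if a unitary operator between the state spaces intertwines them. The Schur class $\mathbf S(\mathfrak M,\mathfrak N)$ is the set of holomorphic contractive $\mathbf L(\mathfrak M,\mathfrak N)$-valued functions on $|\lambda|<1$. The choice sequence $\{\Gamma_n\}$ is the sequence of *Schur parameters* of $\Theta$ if there are $\Theta_n\in\mathbf S(\mathfrak D_{\Gamma_{n-1}},\mathfrak D_{\Gamma_{n-1}^*})$ with $\Theta_0=\Theta$, $\Theta_n(0)=\Gamma_n$ and, for $Z_n(\lambda)=\lambda\Theta_{n+1}(\lambda)$, $\Theta_n(\lambda)=\Gamma_n+D_{\Gamma_n^*}Z_n(\lambda)(I+\Gamma_n^*Z_n(\lambda))^{-1}D_{\Gamma_n}$ for $|\lambda|<1$, $n\ge0$. With $\Gamma=D$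 the feedthrough operator of $\tau$, and $D_T^{-1}$ denoting Moore–Penrose pseudo-inverses, put $$\Omega_{0,1}(\tau)=\begin{bmatrix}D_{\Gamma^*}^{-1}C(D_\Gamma^{-1}B^*)^*&D_{\Gamma^*}^{-1}C{\upharpoonright}\ker D_{A^*}\\ AP_{\ker D_A}D_{A^*}^{-1}B&P_{\ker D_{A^*}}A{\upharpoonright}\ker D_{A^*}\end{bmatrix},\qquad \Omega_{1,0}(\tau)=\begin{bmatrix}D_{\Gamma^*}^{-1}C(D_\Gamma^{-1}B^*)^*&D_{\Gamma^*}^{-1}CA{\upharpoonright}\ker D_A\\ P_{\ker D_A}D_{A^*}^{-1}B&P_{\ker D_A}A{\upharpoonright}\ker D_A\end{bmatrix},$$ with input space $\mathfrak D_\Gamma$, output space $\mathfrak D_{\Gamma^*}$ and state space $\ker D_{A^*}$, respectively $\ker D_A$. **Theorem.** Let $\{\Gamma_n\}_{n\ge0}$ be a choice sequence. 1. The systems $\zeta_0$ and $\widetilde\zeta_0$ are conservative, unitarily equivalent and simple. 2. They have the same transfer function $\Theta$; it belongs to $\mathbf S(\mathfrak M,\mathfrak N)$ and its Schur parameters are $\{\Gamma_n\}_{n\ge0}$.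 In particular, every choice sequence is the sequence of Schur parameters of a Schur class function. 3. Writing elements of $\mathfrak H_0$ and $\widetilde{\mathfrak H}_0$ as $f=\big((h_n,g_n)\big)_{n\ge0}$, $$\ker D_{\mathcal T_0}=\{f:\ (h_0,g_0)=(D_{\Gamma_1}\varphi,-\Gamma_1\varphi)\text{ for some }\varphi\in\mathfrak D_{\Gamma_1}\},\qquad \ker D_{\mathcal T_0^*}=\{f:\ h_0=0\},$$ $$\ker D_{\widetilde{\mathcal T}_0}=\{f:\ h_0=0\},\qquad \ker D_{\widetilde{\mathcal T}_0^*}=\{f:\ (h_0,g_0)=(D_{\Gamma_1^*}\varphi,-\Gamma_1^*\varphi)\text{ for some }\varphi\in\mathfrak D_{\Gamma_1^*}\}.$$ 4. Under the canonical identifications $\widetilde{\mathfrak H}_0(\{\Gamma_n\}_{n\ge1})=\ker D_{\mathcal T_0^*}\subset\mathfrak H_0$ and $\mathfrak H_0(\{\Gamma_n\}_{n\ge1})=\ker D_{\widetilde{\mathcal T}_0}\subset\widetilde{\mathfrak H}_0$ (insert $0$ as the first component and regroup), $\Omega_{0,1}(\zeta_0)$ is the system with block operator $\widetilde{\mathcal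 U}_0(\{\Gamma_n\}_{n\ge1})$ and $\Omega_{1,0}(\widetilde\zeta_0)$ is the system with block operator $\mathcal U_0(\{\Gamma_n\}_{n\ge1})$. -/

import Mathlib

open scoped InnerProductSpace
open ContinuousLinearMap (adjoint)

noncomputable section

namespace CMV

section Defect

variable {E F : Type*}
  [NormedAddCommGroup E] [InnerProductSpace ℂ E] [CompleteSpace E]
  [NormedAddCommGroup F] [InnerProductSpace ℂ F] [CompleteSpace F]

/-- The defect operator `D_T = (I - T^* T)^{1/2}` of a contraction `T` (positive square root). -/
def defectOp (T : E →L[ℂ] F) : E →L[ℂ] E := CFC.sqrt (1 - adjoint T ∘L T)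

/-- The defect subspace `𝔇_T`, the closure of the range of `D_T`. -/
def defectSpace (T : E →L[ℂ] F) : Submodule ℂ E :=
  (LinearMap.range (defectOp T : E →ₗ[ℂ] E)).topologicalClosure

instance (T : E →L[ℂ] F) : CompleteSpace (defectSpace T) :=
  (Submodule.isClosed_topologicalClosure _).completeSpace_coe

/-- The kernel of the defect operator `D_T`. -/
def defectKer (T : E →L[ℂ] F) : Submodule ℂ E := LinearMap.ker (defectOp T : E →ₗ[ℂ] E)

instance (T : E →L[ℂ] F) : CompleteSpace (defectKer T) :=
  (ContinuousLinearMap.isClosed_ker (defectOp T)).completeSpace_coe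

theorem defectOp_norm_le (T : E →L[ℂ] F) (hT : ‖T‖ ≤ 1) : ‖defectOp T‖ ≤ 1 := by
  have h0 : 0 ≤ adjoint T ∘L T :=
    (ContinuousLinearMap.nonneg_iff_isPositive _).2 (ContinuousLinearMap.isPositive_adjoint_comp_self T)
  have h1 : adjoint T ∘L T ≤ 1 := by
    rw [← CStarAlgebra.norm_le_one_iff_of_nonneg _ h0, ContinuousLinearMap.norm_adjoint_comp_self]
    nlinarith [norm_nonneg T]
  have h2 : (0 : E →L[ℂ] E) ≤ 1 - adjoint T ∘L T := sub_nonneg.2 h1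
  have h3 : ‖1 - adjoint T ∘L T‖ ≤ 1 := by
    rw [CStarAlgebra.norm_le_one_iff_of_nonneg _ h2]
    exact sub_le_self _ h0
  have h4 : IsSelfAdjoint (defectOp T) := IsSelfAdjoint.of_nonneg (CFC.sqrt_nonneg _)
  have h5 : defectOp T * defectOp T = 1 - adjoint T ∘L T := CFC.sqrt_mul_sqrt_self _ h2
  have h6 := h4.norm_mul_self
  rw [h5] at h6
  nlinarith [norm_nonneg (defectOp T)]

open Classical in
/-- `D_T^{-1} S`, where `D_T^{-1}` is the Moore-Penrose pseudo-inverse of `D_T`: the (unique)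
bounded operator `K` with values in `𝔇_T = (ker D_T)^⊥` such that `D_T K = S`.
It exists if and only if `ran S ⊆ ran D_T`; otherwise the value is `0` by convention. -/
def defectInvComp {G : Type*} [NormedAddCommGroup G] [InnerProductSpace ℂ G]
    (T : E →L[ℂ] F) (S : G →L[ℂ] E) : G →L[ℂ] defectSpace T :=
  if h : ∃ K : G →L[ℂ] defectSpace T, ∀ x, defectOp T (K x : E) = S x then h.choose else 0

end Defect

section Blocks

variable {E F G K : Type*}
  [NormedAddCommGroup E] [InnerProductSpace ℂ E] [NormedAddCommGroup F] [InnerProductSpace ℂ F]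
  [NormedAddCommGroup G] [InnerProductSpace ℂ G] [NormedAddCommGroup K] [InnerProductSpace ℂ K]

/-- The operator `[a b; c d] : E ⊕ F → G ⊕ K` between orthogonal sums of Hilbert spaces. -/
def blockOp (a : E →L[ℂ] G) (b : F →L[ℂ] G) (c : E →L[ℂ] K) (d : F →L[ℂ] K) :
    WithLp 2 (E × F) →L[ℂ] WithLp 2 (G × K) :=
  (WithLp.prodContinuousLinearEquiv 2 ℂ G K).symm.toContinuousLinearMap ∘L
    ((a.coprod b).prod (c.coprod d)) ∘L
    (WithLp.prodContinuousLinearEquiv 2 ℂ E F).toContinuousLinearMap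

theorem blockOp_fst (a : E →L[ℂ] G) (b : F →L[ℂ] G) (c : E →L[ℂ] K) (d : F →L[ℂ] K)
    (v : WithLp 2 (E × F)) : (blockOp a b c d v).fst = a v.fst + b v.snd := rfl

theorem blockOp_snd (a : E →L[ℂ] G) (b : F →L[ℂ] G) (c : E →L[ℂ] K) (d : F →L[ℂ] K)
    (v : WithLp 2 (E × F)) : (blockOp a b c d v).snd = c v.fst + d v.snd := rfl

theorem blockOp_norm_le {a : E →L[ℂ] G} {b : F →L[ℂ] G} {c : E →L[ℂ] K} {d : F →L[ℂ] K}
    (ha : ‖a‖ ≤ 1) (hb : ‖b‖ ≤ 1) (hc : ‖c‖ ≤ 1) (hd : ‖d‖ ≤ 1) : ‖blockOp a b c d‖ ≤ 2 := by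
  refine ContinuousLinearMap.opNorm_le_bound _ (by norm_num) fun v => ?_
  have h1 : ‖a v.fst + b v.snd‖ ≤ ‖v.fst‖ + ‖v.snd‖ :=
    (norm_add_le _ _).trans (add_le_add (a.le_of_opNorm_le ha _ |>.trans (one_mul _).le)
      (b.le_of_opNorm_le hb _ |>.trans (one_mul _).le))
  have h2 : ‖c v.fst + d v.snd‖ ≤ ‖v.fst‖ + ‖v.snd‖ :=
    (norm_add_le _ _).trans (add_le_add (c.le_of_opNorm_le hc _ |>.trans (one_mul _).le)
      (d.le_of_opNorm_le hd _ |>.trans (one_mul _).le))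
  have h3 := WithLp.prod_norm_sq_eq_of_L2 v
  have h4 := WithLp.prod_norm_sq_eq_of_L2 (blockOp a b c d v)
  rw [blockOp_fst, blockOp_snd] at h4
  have h5 := pow_le_pow_left₀ (norm_nonneg _) h1 2
  have h6 := pow_le_pow_left₀ (norm_nonneg _) h2 2
  refine le_of_sq_le_sq ?_ (by positivity)
  nlinarith [sq_nonneg (‖v.fst‖ - ‖v.snd‖)]

end Blocks

section HilbertSums

/-- The orthogonal sum `∑_n ⊕ (P n ⊕ Q n)` of a sequence of orthogonal sums of two Hilbert
spaces. -/
abbrev PairSum (P Q : ℕ → Type*) [∀ n, NormedAddCommGroup (P n)]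
    [∀ n, NormedAddCommGroup (Q n)] : Type _ :=
  lp (fun n => WithLp 2 (P n × Q n)) 2

variable {P : ℕ → Type*} [∀ n, NormedAddCommGroup (P n)] [∀ n, InnerProductSpace ℂ (P n)]
  {Q : ℕ → Type*} [∀ n, NormedAddCommGroup (Q n)] [∀ n, InnerProductSpace ℂ (Q n)]

theorem summable_sq_norm {E : ℕ → Type*} [∀ n, NormedAddCommGroup (E n)] (f : lp E 2) :
    Summable fun n => ‖f n‖ ^ 2 := by
  simpa using (lp.memℓp f).summable (by norm_num)

theorem norm_sq_eq_tsum {E : ℕ → Type*} [∀ n, NormedAddCommGroup (E n)] (f : lp E 2) :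
    ‖f‖ ^ 2 = ∑' n, ‖f n‖ ^ 2 := by
  simpa using lp.norm_rpow_eq_tsum (p := 2) (by norm_num) f

theorem memℓp_two {E : ℕ → Type*} [∀ n, NormedAddCommGroup (E n)] {f : ∀ n, E n}
    (h : Summable fun n => ‖f n‖ ^ 2) : Memℓp f 2 :=
  memℓp_gen (by simpa using h)

/-- The block diagonal operator `∑_n ⊕ S n` given by a uniformly bounded sequence of operators. -/
def diagOp {E F : ℕ → Type*}
    [∀ n, NormedAddCommGroup (E n)] [∀ n, InnerProductSpace ℂ (E n)]
    [∀ n, NormedAddCommGroup (F n)] [∀ n, InnerProductSpace ℂ (F n)]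
    (S : ∀ n, E n →L[ℂ] F n) (c : ℝ) (hS : ∀ n, ‖S n‖ ≤ c) : lp E 2 →L[ℂ] lp F 2 :=
  have hb : ∀ (f : lp E 2) n, ‖S n (f n)‖ ^ 2 ≤ c ^ 2 * ‖f n‖ ^ 2 := fun f n => by
    rw [← mul_pow]
    exact pow_le_pow_left₀ (norm_nonneg _) ((S n).le_of_opNorm_le (hS n) _) 2
  have hs : ∀ f : lp E 2, Summable fun n => ‖S n (f n)‖ ^ 2 := fun f =>
    ((summable_sq_norm f).mul_left (c ^ 2)).of_nonneg_of_le (fun _ => sq_nonneg _) (hb f)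
  LinearMap.mkContinuous
    { toFun := fun f => ⟨fun n => S n (f n), memℓp_two (hs f)⟩
      map_add' := fun f g => by
        ext n
        exact map_add (S n) (f n) (g n)
      map_smul' := fun z f => by
        ext n
        exact map_smul (S n) z (f n) } c <| fun f => by
    have hc : 0 ≤ c := (norm_nonneg _).trans (hS 0)
    refine le_of_sq_le_sq ?_ (by positivity)
    rw [norm_sq_eq_tsum, mul_pow, norm_sq_eq_tsum f, ← tsum_mul_left]
    exact (hs f).tsum_le_tsum (hb f) ((summable_sq_norm f).mul_left (c ^ 2))

@[simp]
theorem diagOp_apply {E F : ℕ → Type*}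
    [∀ n, NormedAddCommGroup (E n)] [∀ n, InnerProductSpace ℂ (E n)]
    [∀ n, NormedAddCommGroup (F n)] [∀ n, InnerProductSpace ℂ (F n)]
    (S : ∀ n, E n →L[ℂ] F n) (c : ℝ) (hS : ∀ n, ‖S n‖ ≤ c) (f : lp E 2) (n : ℕ) :
    diagOp S c hS f n = S n (f n) := rfl

theorem regroup_hasSum (f : WithLp 2 (P 0 × PairSum Q (fun n => P (n + 1)))) :
    HasSum (fun n => ‖(Nat.casesOn n f.fst fun k => (f.snd k).snd : P n)‖ ^ 2 +
      ‖(f.snd n).fst‖ ^ 2) (‖f‖ ^ 2) := by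
  have hs := summable_sq_norm f.snd
  simp only [WithLp.prod_norm_sq_eq_of_L2] at hs
  have h1 : Summable fun n => ‖(f.snd n).fst‖ ^ 2 :=
    hs.of_nonneg_of_le (fun _ => sq_nonneg _) fun n => le_add_of_nonneg_right (sq_nonneg _)
  have h2 : Summable fun n => ‖(f.snd n).snd‖ ^ 2 :=
    hs.of_nonneg_of_le (fun _ => sq_nonneg _) fun n => le_add_of_nonneg_left (sq_nonneg _)
  have h3 : Summable fun n => ‖(Nat.casesOn n f.fst fun k => (f.snd k).snd : P n)‖ ^ 2 :=
    (summable_nat_add_iff 1).1 h2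
  have h4 := (h3.add h1).hasSum
  have h5 : (∑' n, (‖(f.snd n).snd‖ ^ 2 + ‖(f.snd n).fst‖ ^ 2)) = ‖f.snd‖ ^ 2 := by
    rw [norm_sq_eq_tsum]
    exact tsum_congr fun n => (add_comm _ _).trans (WithLp.prod_norm_sq_eq_of_L2 _).symm
  rw [h3.tsum_add h1, h3.tsum_eq_zero_add, add_assoc, ← h2.tsum_add h1, h5] at h4
  rw [WithLp.prod_norm_sq_eq_of_L2 f]
  exact h4

/-- The canonical identification
`P 0 ⊕ ∑_n ⊕ (Q n ⊕ P (n+1)) = ∑_n ⊕ (P n ⊕ Q n)`. -/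
def regroup (P Q : ℕ → Type*)
    [∀ n, NormedAddCommGroup (P n)] [∀ n, InnerProductSpace ℂ (P n)]
    [∀ n, NormedAddCommGroup (Q n)] [∀ n, InnerProductSpace ℂ (Q n)] :
    WithLp 2 (P 0 × PairSum Q (fun n => P (n + 1))) ≃ₗᵢ[ℂ] PairSum P Q where
  toFun f := ⟨fun n => WithLp.toLp 2 (Nat.casesOn n f.fst fun k => (f.snd k).snd, (f.snd n).fst),
    memℓp_two (by
      simp only [WithLp.prod_norm_sq_eq_of_L2]
      exact (regroup_hasSum f).summable)⟩
  map_add' f g := by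
    ext n
    cases n <;> rfl
  map_smul' c f := by
    ext n
    cases n <;> rfl
  invFun g := WithLp.toLp 2 ((g 0).fst,
    ⟨fun n => WithLp.toLp 2 ((g n).snd, (g (n + 1)).fst), memℓp_two (by
      have hs := summable_sq_norm g
      simp only [WithLp.prod_norm_sq_eq_of_L2] at hs ⊢
      have h1 : Summable fun n => ‖(g n).fst‖ ^ 2 :=
        hs.of_nonneg_of_le (fun _ => sq_nonneg _) fun n => le_add_of_nonneg_right (sq_nonneg _)
      have h2 : Summable fun n => ‖(g n).snd‖ ^ 2 :=
        hs.of_nonneg_of_le (fun _ => sq_nonneg _) fun n => le_add_of_nonneg_left (sq_nonneg _)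
      exact h2.add ((summable_nat_add_iff 1).2 h1))⟩)
  left_inv f := rfl
  right_inv g := by
    ext n
    cases n <;> rfl
  norm_map' f := by
    refine (sq_eq_sq₀ (norm_nonneg _) (norm_nonneg _)).1 ?_
    rw [norm_sq_eq_tsum]
    refine Eq.trans ?_ (regroup_hasSum f).tsum_eq
    exact tsum_congr fun n => WithLp.prod_norm_sq_eq_of_L2 _

end HilbertSums

/-- A discrete time-invariant linear system
`σ_k = C h_k + D ξ_k`, `h_{k+1} = A h_k + B ξ_k`
with input space `M`, output space `N` and state space `H`. -/
@[ext]
structure LinSys (M N H : Type*)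
    [NormedAddCommGroup M] [InnerProductSpace ℂ M] [NormedAddCommGroup N] [InnerProductSpace ℂ N]
    [NormedAddCommGroup H] [InnerProductSpace ℂ H] where
  /-- feedthrough operator -/
  D : M →L[ℂ] N
  /-- observation operator -/
  C : H →L[ℂ] N
  /-- control operator -/
  B : M →L[ℂ] H
  /-- state space operator -/
  A : H →L[ℂ] H

namespace LinSys

variable {M N H : Type*}
  [NormedAddCommGroup M] [InnerProductSpace ℂ M] [CompleteSpace M]
  [NormedAddCommGroup N] [InnerProductSpace ℂ N] [CompleteSpace N]
  [NormedAddCommGroup H] [InnerProductSpace ℂ H] [CompleteSpace H]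

/-- The block operator `U_τ = [D C; B A] : M ⊕ H → N ⊕ H`. -/
def colligation (τ : LinSys M N H) : WithLp 2 (M × H) →L[ℂ] WithLp 2 (N × H) :=
  blockOp τ.D τ.C τ.B τ.A

/-- The system whose block operator is a given `U : M ⊕ H → N ⊕ H`. -/
def ofColligation (U : WithLp 2 (M × H) →L[ℂ] WithLp 2 (N × H)) : LinSys M N H where
  D := WithLp.fstL 2 ℂ N H ∘L U ∘L
    (WithLp.prodContinuousLinearEquiv 2 ℂ M H).symm.toContinuousLinearMap ∘L .inl ℂ M H
  C := WithLp.fstL 2 ℂ N H ∘L U ∘L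
    (WithLp.prodContinuousLinearEquiv 2 ℂ M H).symm.toContinuousLinearMap ∘L .inr ℂ M H
  B := WithLp.sndL 2 ℂ N H ∘L U ∘L
    (WithLp.prodContinuousLinearEquiv 2 ℂ M H).symm.toContinuousLinearMap ∘L .inl ℂ M H
  A := WithLp.sndL 2 ℂ N H ∘L U ∘L
    (WithLp.prodContinuousLinearEquiv 2 ℂ M H).symm.toContinuousLinearMap ∘L .inr ℂ M H

theorem colligation_ofColligation (U : WithLp 2 (M × H) →L[ℂ] WithLp 2 (N × H)) :
    (ofColligation U).colligation = U := by
  ext v : 1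
  have hv : v = WithLp.toLp 2 (v.fst, 0) + WithLp.toLp 2 (0, v.snd) := by
    apply WithLp.ofLp_injective
    exact Prod.ext (add_zero _).symm (zero_add _).symm
  have hU := congrArg U hv
  rw [map_add] at hU
  rw [hU]
  rfl

/-- The system is conservative: `U_τ` is unitary. -/
def IsConservative (τ : LinSys M N H) : Prop :=
  adjoint τ.colligation ∘L τ.colligation = .id ℂ _ ∧
    τ.colligation ∘L adjoint τ.colligation = .id ℂ _

/-- The system is simple: the closed linear span of
`A^k B M` and `A^{*l} C^* N`, `k, l ≥ 0`, is the whole state space. -/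
def IsSimple (τ : LinSys M N H) : Prop :=
  (Submodule.span ℂ
    ({h : H | ∃ (k : ℕ) (x : M), h = (τ.A ^ k) (τ.B x)} ∪
      {h : H | ∃ (l : ℕ) (y : N), h = (adjoint τ.A ^ l) (adjoint τ.C y)})).topologicalClosure = ⊤

/-- The transfer function `Θ_τ(z) = D + z C (I - z A)^{-1} B`. -/
def transfer (τ : LinSys M N H) (z : ℂ) : M →L[ℂ] N :=
  τ.D + z • (τ.C ∘L Ring.inverse (1 - z • τ.A) ∘L τ.B)

/-- The systems `σ` and `τ` correspond to each other under given unitary identifications of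
their input, output and state spaces. -/
def Intertwines {M' N' H' : Type*}
    [NormedAddCommGroup M'] [InnerProductSpace ℂ M'] [NormedAddCommGroup N']
    [InnerProductSpace ℂ N'] [NormedAddCommGroup H'] [InnerProductSpace ℂ H']
    (σ : LinSys M' N' H') (τ : LinSys M N H)
    (u : M' ≃ₗᵢ[ℂ] M) (v : N' ≃ₗᵢ[ℂ] N) (w : H' ≃ₗᵢ[ℂ] H) : Prop :=
  (∀ x, v (σ.D x) = τ.D (u x)) ∧ (∀ h, v (σ.C h) = τ.C (w h)) ∧
    (∀ x, w (σ.B x) = τ.B (u x)) ∧ (∀ h, w (σ.A h) = τ.A (w h))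

/-- Unitary equivalence of two systems with the same input and output spaces. -/
def UnitarilyEquivalent {H' : Type*} [NormedAddCommGroup H'] [InnerProductSpace ℂ H']
    (σ : LinSys M N H') (τ : LinSys M N H) : Prop :=
  ∃ w : H' ≃ₗᵢ[ℂ] H, σ.Intertwines τ (.refl ℂ M) (.refl ℂ N) w

/-- The transformation `Ω_{0,1}`, `Γ` being the feedthrough operator of `τ`: the blocks are
`D_{Γ^*}^{-1} C (D_Γ^{-1} B^*)^*`, `D_{Γ^*}^{-1} C ↾ ker D_{A^*}`,
`A P_{ker D_A} D_{A^*}^{-1} B ↾ 𝔇_Γ` and `P_{ker D_{A^*}} A ↾ ker D_{A^*}`,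
with state space `ker D_{A^*}`.  (For a conservative system `A` maps `ker D_A` into
`ker D_{A^*}`, so the projection in front of the third block only fixes its codomain.) -/
def omega01 (τ : LinSys M N H) :
    LinSys (defectSpace τ.D) (defectSpace (adjoint τ.D)) (defectKer (adjoint τ.A)) where
  D := defectInvComp (adjoint τ.D) τ.C ∘L adjoint (defectInvComp τ.D (adjoint τ.B))
  C := defectInvComp (adjoint τ.D) τ.C ∘L (defectKer (adjoint τ.A)).subtypeL
  B := (defectKer (adjoint τ.A)).orthogonalProjectionOnto ∘L τ.A ∘L
    (defectKer τ.A).subtypeL ∘L (defectKer τ.A).orthogonalProjectionOnto ∘L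
    (defectSpace (adjoint τ.A)).subtypeL ∘L defectInvComp (adjoint τ.A) τ.B ∘L
    (defectSpace τ.D).subtypeL
  A := (defectKer (adjoint τ.A)).orthogonalProjectionOnto ∘L τ.A ∘L
    (defectKer (adjoint τ.A)).subtypeL

/-- The transformation `Ω_{1,0}`, `Γ` being the feedthrough operator of `τ`: the blocks are
`D_{Γ^*}^{-1} C (D_Γ^{-1} B^*)^*`, `D_{Γ^*}^{-1} C A ↾ ker D_A`,
`P_{ker D_A} D_{A^*}^{-1} B ↾ 𝔇_Γ` and `P_{ker D_A} A ↾ ker D_A`,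
with state space `ker D_A`. -/
def omega10 (τ : LinSys M N H) :
    LinSys (defectSpace τ.D) (defectSpace (adjoint τ.D)) (defectKer τ.A) where
  D := defectInvComp (adjoint τ.D) τ.C ∘L adjoint (defectInvComp τ.D (adjoint τ.B))
  C := defectInvComp (adjoint τ.D) τ.C ∘L τ.A ∘L (defectKer τ.A).subtypeL
  B := (defectKer τ.A).orthogonalProjectionOnto ∘L
    (defectSpace (adjoint τ.A)).subtypeL ∘L defectInvComp (adjoint τ.A) τ.B ∘L
    (defectSpace τ.D).subtypeL
  A := (defectKer τ.A).orthogonalProjectionOnto ∘L τ.A ∘L (defectKer τ.A).subtypeL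

end LinSys

/-- The Schur class `S(M, N)`: functions that are holomorphic and contractive in the open unit
disk (values outside the disk are irrelevant). -/
def SchurClass {M N : Type*} [NormedAddCommGroup M] [InnerProductSpace ℂ M]
    [NormedAddCommGroup N] [InnerProductSpace ℂ N] (Θ : ℂ → M →L[ℂ] N) : Prop :=
  DifferentiableOn ℂ Θ (Metric.ball 0 1) ∧ ∀ z ∈ Metric.ball (0 : ℂ) 1, ‖Θ z‖ ≤ 1

/-- A choice sequence: contractions `Γ_0 : X 0 → Y 0` and
`Γ_{n+1} : 𝔇_{Γ_n} → 𝔇_{Γ_n^*}`.  The space `X (n+1)` is the defect subspace `𝔇_{Γ_n}` of `X n`,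
included into `X n` by the isometry `inclX n`, and `Y (n+1)` is the defect subspace `𝔇_{Γ_n^*}`
of `Y n`, included into `Y n` by the isometry `inclY n`. -/
structure ChoiceSequence (X Y : ℕ → Type*)
    [∀ n, NormedAddCommGroup (X n)] [∀ n, InnerProductSpace ℂ (X n)] [∀ n, CompleteSpace (X n)]
    [∀ n, NormedAddCommGroup (Y n)] [∀ n, InnerProductSpace ℂ (Y n)] [∀ n, CompleteSpace (Y n)]
    where
  /-- the contraction `Γ_n` -/
  op : ∀ n, X n →L[ℂ] Y n
  norm_op_le : ∀ n, ‖op n‖ ≤ 1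
  /-- the inclusion of `𝔇_{Γ_n}` into `X n` -/
  inclX : ∀ n, X (n + 1) →ₗᵢ[ℂ] X n
  range_inclX : ∀ n, LinearMap.range (inclX n).toLinearMap = defectSpace (op n)
  /-- the inclusion of `𝔇_{Γ_n^*}` into `Y n` -/
  inclY : ∀ n, Y (n + 1) →ₗᵢ[ℂ] Y n
  range_inclY : ∀ n, LinearMap.range (inclY n).toLinearMap = defectSpace (adjoint (op n))

namespace ChoiceSequence

variable {X Y : ℕ → Type*}
  [∀ n, NormedAddCommGroup (X n)] [∀ n, InnerProductSpace ℂ (X n)] [∀ n, CompleteSpace (X n)]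
  [∀ n, NormedAddCommGroup (Y n)] [∀ n, InnerProductSpace ℂ (Y n)] [∀ n, CompleteSpace (Y n)]
  (Γ : ChoiceSequence X Y)

/-- The shifted choice sequence `{Γ_n}_{n ≥ 1}`. -/
def tail : ChoiceSequence (fun n => X (n + 1)) (fun n => Y (n + 1)) where
  op n := Γ.op (n + 1)
  norm_op_le n := Γ.norm_op_le (n + 1)
  inclX n := Γ.inclX (n + 1)
  range_inclX n := Γ.range_inclX (n + 1)
  inclY n := Γ.inclY (n + 1)
  range_inclY n := Γ.range_inclY (n + 1)

/-- `D_{Γ_n}` as an operator from `X n` to `𝔇_{Γ_n}`.  (The adjoint of the inclusion of a subspace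
is the orthogonal projection onto it, here applied to vectors that belong to the subspace.) -/
def defX (n : ℕ) : X n →L[ℂ] X (n + 1) :=
  adjoint (Γ.inclX n).toContinuousLinearMap ∘L defectOp (Γ.op n)

/-- `D_{Γ_n^*}` restricted to `𝔇_{Γ_n^*}`. -/
def defY (n : ℕ) : Y (n + 1) →L[ℂ] Y n :=
  defectOp (adjoint (Γ.op n)) ∘L (Γ.inclY n).toContinuousLinearMap

/-- `Γ_n^*` as an operator from `𝔇_{Γ_n^*}` to `𝔇_{Γ_n}`. -/
def adj (n : ℕ) : Y (n + 1) →L[ℂ] X (n + 1) :=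
  adjoint (Γ.inclX n).toContinuousLinearMap ∘L adjoint (Γ.op n) ∘L
    (Γ.inclY n).toContinuousLinearMap

/-- The elementary rotation
`J_{Γ_n} = [Γ_n  D_{Γ_n^*}; D_{Γ_n}  -Γ_n^*] : X n ⊕ 𝔇_{Γ_n^*} → Y n ⊕ 𝔇_{Γ_n}`. -/
def J (n : ℕ) : WithLp 2 (X n × Y (n + 1)) →L[ℂ] WithLp 2 (Y n × X (n + 1)) :=
  blockOp (Γ.op n) (Γ.defY n) (Γ.defX n) (-Γ.adj n)

theorem J_norm_le (n : ℕ) : ‖Γ.J n‖ ≤ 2 := by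
  have hX : ‖adjoint (Γ.inclX n).toContinuousLinearMap‖ ≤ 1 := by
    rw [LinearIsometryEquiv.norm_map]
    exact (Γ.inclX n).norm_toContinuousLinearMap_le
  have hY : ‖(Γ.inclY n).toContinuousLinearMap‖ ≤ 1 := (Γ.inclY n).norm_toContinuousLinearMap_le
  have hT : ‖adjoint (Γ.op n)‖ ≤ 1 := by
    rw [LinearIsometryEquiv.norm_map]
    exact Γ.norm_op_le n
  have key : ∀ a b : ℝ, 0 ≤ b → a ≤ 1 → b ≤ 1 → a * b ≤ 1 := fun a b hb h1 h2 => by nlinarith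
  refine blockOp_norm_le (Γ.norm_op_le n) ?_ ?_ ?_
  · exact (ContinuousLinearMap.opNorm_comp_le _ _).trans
      (key _ _ (norm_nonneg _) (defectOp_norm_le _ hT) hY)
  · exact (ContinuousLinearMap.opNorm_comp_le _ _).trans
      (key _ _ (norm_nonneg _) hX (defectOp_norm_le _ (Γ.norm_op_le n)))
  · rw [norm_neg]
    exact (ContinuousLinearMap.opNorm_comp_le _ _).trans (key _ _ (norm_nonneg _) hX
      ((ContinuousLinearMap.opNorm_comp_le _ _).trans (key _ _ (norm_nonneg _) hT hY)))

/-- The space `ℌ_0 = ∑_{n ≥ 0} ⊕ (𝔇_{Γ_{2n}} ⊕ 𝔇_{Γ_{2n+1}^*})`. -/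
abbrev StateSpace (_Γ : ChoiceSequence X Y) : Type _ :=
  PairSum (fun n => X (2 * n + 1)) (fun n => Y (2 * (n + 1)))

/-- The space `ℌ̃_0 = ∑_{n ≥ 0} ⊕ (𝔇_{Γ_{2n}^*} ⊕ 𝔇_{Γ_{2n+1}})`. -/
abbrev StateSpaceT (_Γ : ChoiceSequence X Y) : Type _ :=
  PairSum (fun n => Y (2 * n + 1)) (fun n => X (2 * (n + 1)))

/-- `V_0 = ∑_{n ≥ 0} ⊕ J_{Γ_{2n+1}} : ℌ_0 → ℌ̃_0`. -/
def opV : Γ.StateSpace →L[ℂ] Γ.StateSpaceT :=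
  diagOp (fun n => Γ.J (2 * n + 1)) 2 fun n => Γ.J_norm_le (2 * n + 1)

/-- `M_0 = I ⊕ V_0 : X 0 ⊕ ℌ_0 → X 0 ⊕ ℌ̃_0`. -/
def opM : WithLp 2 (X 0 × Γ.StateSpace) →L[ℂ] WithLp 2 (X 0 × Γ.StateSpaceT) :=
  blockOp (.id ℂ _) 0 0 Γ.opV

/-- `M̃_0 = I ⊕ V_0 : Y 0 ⊕ ℌ_0 → Y 0 ⊕ ℌ̃_0`. -/
def opMT : WithLp 2 (Y 0 × Γ.StateSpace) →L[ℂ] WithLp 2 (Y 0 × Γ.StateSpaceT) :=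
  blockOp (.id ℂ _) 0 0 Γ.opV

/-- `L_0 = J_{Γ_0} ⊕ ∑_{n ≥ 1} ⊕ J_{Γ_{2n}} : X 0 ⊕ ℌ̃_0 → Y 0 ⊕ ℌ_0`, where the spaces are
written as `∑_{n ≥ 0} ⊕ (X (2n) ⊕ 𝔇_{Γ_{2n}^*})` and `∑_{n ≥ 0} ⊕ (Y (2n) ⊕ 𝔇_{Γ_{2n}})`. -/
def opL : WithLp 2 (X 0 × Γ.StateSpaceT) →L[ℂ] WithLp 2 (Y 0 × Γ.StateSpace) :=
  (regroup (fun n => Y (2 * n))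
      (fun n => X (2 * n + 1))).symm.toContinuousLinearEquiv.toContinuousLinearMap ∘L
    diagOp (fun n => Γ.J (2 * n)) 2 (fun n => Γ.J_norm_le (2 * n)) ∘L
    (regroup (fun n => X (2 * n))
      (fun n => Y (2 * n + 1))).toContinuousLinearEquiv.toContinuousLinearMap

/-- The block operator CMV matrix `U_0 = L_0 M_0`. -/
def opU : WithLp 2 (X 0 × Γ.StateSpace) →L[ℂ] WithLp 2 (Y 0 × Γ.StateSpace) :=
  Γ.opL ∘L Γ.opM

/-- The block operator CMV matrix `Ũ_0 = M̃_0 L_0`. -/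
def opUT : WithLp 2 (X 0 × Γ.StateSpaceT) →L[ℂ] WithLp 2 (Y 0 × Γ.StateSpaceT) :=
  Γ.opMT ∘L Γ.opL

/-- The system `ζ_0` with block operator `U_0`. -/
def zeta : LinSys (X 0) (Y 0) Γ.StateSpace := .ofColligation Γ.opU

/-- The system `ζ̃_0` with block operator `Ũ_0`. -/
def zetaT : LinSys (X 0) (Y 0) Γ.StateSpaceT := .ofColligation Γ.opUT

/-- The truncated block operator CMV matrix `T_0 = P U_0 ↾ ℌ_0`, with `P` the orthogonal projection
onto `ℌ_0`. -/
def trunc : Γ.StateSpace →L[ℂ] Γ.StateSpace := Γ.zeta.A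

/-- The truncated block operator CMV matrix `T̃_0 = P Ũ_0 ↾ ℌ̃_0`, with `P` the orthogonal
projection onto `ℌ̃_0`. -/
def truncT : Γ.StateSpaceT →L[ℂ] Γ.StateSpaceT := Γ.zetaT.A

/-- `{Γ_n}` are the Schur parameters of `Θ`: the operator Schur algorithm started at `Θ_0 = Θ`
produces Schur class functions `Θ_n` (the Schur iterates) with `Θ_n(0) = Γ_n` such that
`Z(z) = z Θ_{n+1}(z)` is the Möbius parameter of `Θ_n`, that is,
`Θ_n(z) = Γ_n + D_{Γ_n^*} Z(z) (I + Γ_n^* Z(z))^{-1} D_{Γ_n}` for `|z| < 1`. -/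
def IsSchurParametersOf (Θ : ℂ → X 0 →L[ℂ] Y 0) : Prop :=
  ∃ it : ∀ n, ℂ → X n →L[ℂ] Y n,
    (∀ z ∈ Metric.ball (0 : ℂ) 1, it 0 z = Θ z) ∧
    ∀ n, SchurClass (it n) ∧ it n 0 = Γ.op n ∧
      ∀ z ∈ Metric.ball (0 : ℂ) 1,
        it n z = Γ.op n + Γ.defY n ∘L (z • it (n + 1) z) ∘L
          Ring.inverse (1 + Γ.adj n ∘L (z • it (n + 1) z)) ∘L Γ.defX n

end ChoiceSequence

end CMV

end

/-!
The two block operator CMV matrices satisfy a recursion in the choice sequence. Write `Γ'` for the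
shifted sequence `{Γ_n}_{n ≥ 1}`. Regrouping the summands identifies `ℌ_0` with
`𝔇_{Γ_0} ⊕ ℌ̃_0(Γ')` and `ℌ̃_0` with `𝔇_{Γ_0^*} ⊕ ℌ_0(Γ')` (`glue`, `glueT`). Under these
identifications `V_0 = L_0(Γ')` and `L_0 = J_{Γ_0} ⊕ V_0(Γ')` (`opV_glue`, `opL_glueT`), hence

  `U_0 = (J_{Γ_0} ⊕ I)(I ⊕ Ũ_0(Γ'))` and `Ũ_0 = (I ⊕ U_0(Γ'))(J_{Γ_0} ⊕ I)`

(`opU_glue`, `opUT_glueT`). Since `T D_T = D_{T^*} T` (`map_defectOp`), the rotations `J_{Γ_n}` are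
unitary, and so are `V_0`, `L_0`, `U_0` and `Ũ_0`; also `V_0` intertwines the two systems.

* Transfer functions. The value `Θ(z) x` is characterized by `U (x, z g) = (Θ(z) x, g)` for some
  state `g`, and unitarity of `U` makes `Θ(z)` a contraction. Inserted into this equation, the
  recursion for `U_0` is the Möbius representation of `Θ` with parameter `z Θ_1(z)`, where `Θ_1` is
  the transfer function belonging to `Γ'` (`transfer_zeta_eq_moebius`). So the Schur iterates are the
  transfer functions of the repeatedly shifted sequences.
* Simplicity. On the orthogonal complement of the controllable and observable states a unitary `U`
  restricts to a bijection with zero input and output. By the recursion and the injectivity of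
  `D_{Γ_0^*}` on `𝔇_{Γ_0^*}`, the first component of such a state vanishes, and the remaining ones
  form a state of the same kind for `Γ'` (`isHidden_opU`, `isHidden_opUT`). By induction all
  components vanish.
* Kernels and `Ω`. For a conservative system `ker D_A = ker C` and `ker D_{A^*} = ker B^*`. Both
  systems have `B = W D_Γ` for an isometry `W` of `𝔇_Γ` and `C = D_{Γ^*} Z`, so that the
  pseudo-inverses can be computed: `D_{Γ^*}^{-1} C = Z`, `(D_Γ^{-1} B^*)^* = W` and
  `D_{A^*}^{-1} B = W` on `𝔇_Γ` (`defectInvComp_C`, `adjoint_defectInvComp_B`, `defectInvComp_B`).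
  The recursion then gives the blocks of `Ω_{0,1}` and `Ω_{1,0}`.
-/

noncomputable section

namespace CMV

/-! ### Defect operators -/

theorem isPositive_blockOp_diag {E F : Type*}
    [NormedAddCommGroup E] [InnerProductSpace ℂ E] [NormedAddCommGroup F] [InnerProductSpace ℂ F]
    {S : E →L[ℂ] E} {R : F →L[ℂ] F} (hS : S.IsPositive)
    (hR : R.IsPositive) : (blockOp S 0 0 R).IsPositive := by
  refine ⟨fun v w => ?_, fun v => ?_⟩
  · have h1 := hS.isSymmetric v.fst w.fst
    have h2 := hR.isSymmetric v.snd w.snd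
    simp only [ContinuousLinearMap.coe_coe] at h1 h2
    simp [blockOp_fst, blockOp_snd, h1, h2]
  · have h1 := hS.2 v.fst
    have h2 := hR.2 v.snd
    simp only [ContinuousLinearMap.reApplyInnerSelf_apply] at h1 h2 ⊢
    simpa [blockOp_fst, blockOp_snd] using add_nonneg h1 h2

section DefectOperators

variable {E F G : Type*}
  [NormedAddCommGroup E] [InnerProductSpace ℂ E] [CompleteSpace E]
  [NormedAddCommGroup F] [InnerProductSpace ℂ F] [CompleteSpace F]
  [NormedAddCommGroup G] [InnerProductSpace ℂ G]

theorem isSelfAdjoint_defectOp (T : E →L[ℂ] F) : IsSelfAdjoint (defectOp T) :=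
  IsSelfAdjoint.of_nonneg (CFC.sqrt_nonneg _)

theorem inner_defectOp_left (T : E →L[ℂ] F) (x y : E) :
    ⟪defectOp T x, y⟫_ℂ = ⟪x, defectOp T y⟫_ℂ :=
  (isSelfAdjoint_defectOp T).isSymmetric x y

theorem one_sub_adjoint_comp_nonneg {T : E →L[ℂ] F} (hT : ‖T‖ ≤ 1) :
    0 ≤ 1 - adjoint T ∘L T := by
  have h0 : 0 ≤ adjoint T ∘L T :=
    (ContinuousLinearMap.nonneg_iff_isPositive _).2
      (ContinuousLinearMap.isPositive_adjoint_comp_self T)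
  rw [sub_nonneg, ← CStarAlgebra.norm_le_one_iff_of_nonneg _ h0,
    ContinuousLinearMap.norm_adjoint_comp_self]
  nlinarith [norm_nonneg T]

theorem norm_adjoint_le_one {T : E →L[ℂ] F} (hT : ‖T‖ ≤ 1) : ‖adjoint T‖ ≤ 1 := by
  rwa [LinearIsometryEquiv.norm_map]

theorem defectOp_defectOp {T : E →L[ℂ] F} (hT : ‖T‖ ≤ 1) (x : E) :
    defectOp T (defectOp T x) = x - adjoint T (T x) :=
  DFunLike.congr_fun (CFC.sqrt_mul_sqrt_self _ (one_sub_adjoint_comp_nonneg hT)) x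

theorem norm_sq_defectOp {T : E →L[ℂ] F} (hT : ‖T‖ ≤ 1) (x : E) :
    ‖defectOp T x‖ ^ 2 = ‖x‖ ^ 2 - ‖T x‖ ^ 2 := by
  have h : ⟪defectOp T x, defectOp T x⟫_ℂ = ⟪x, x⟫_ℂ - ⟪T x, T x⟫_ℂ := by
    rw [inner_defectOp_left, defectOp_defectOp hT, inner_sub_right,
      ContinuousLinearMap.adjoint_inner_right]
  simp only [inner_self_eq_norm_sq_to_K] at h
  exact_mod_cast h

theorem mem_defectKer_iff (T : E →L[ℂ] F) (x : E) : x ∈ defectKer T ↔ defectOp T x = 0 :=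
  Iff.rfl

theorem mem_defectKer_iff_norm {T : E →L[ℂ] F} (hT : ‖T‖ ≤ 1) (x : E) :
    x ∈ defectKer T ↔ ‖T x‖ ^ 2 = ‖x‖ ^ 2 := by
  rw [mem_defectKer_iff, ← norm_eq_zero, ← sq_eq_zero_iff, norm_sq_defectOp hT, sub_eq_zero,
    eq_comm]

/-- Uniqueness of the positive square root. -/
theorem defectOp_eq {T : E →L[ℂ] F} {S : E →L[ℂ] E} (hS : S.IsPositive)
    (h : ∀ x, S (S x) = x - adjoint T (T x)) : defectOp T = S :=
  CFC.sqrt_unique (ContinuousLinearMap.ext h) ((ContinuousLinearMap.nonneg_iff_isPositive _).2 hS)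

theorem isPositive_defectOp (T : E →L[ℂ] F) : (defectOp T).IsPositive :=
  (ContinuousLinearMap.nonneg_iff_isPositive _).1 (CFC.sqrt_nonneg _)

/-- The relation `T D_T = D_{T^*} T`. It holds because `D_T ⊕ D_{T^*}` is the positive square root
of `I - Q^2` for the self-adjoint operator `Q = [0 T^*; T 0]`, and so commutes with `Q`. -/
theorem map_defectOp {T : E →L[ℂ] F} (hT : ‖T‖ ≤ 1) (x : E) :
    T (defectOp T x) = defectOp (adjoint T) (T x) := by
  set Q : WithLp 2 (E × F) →L[ℂ] WithLp 2 (E × F) := blockOp 0 (adjoint T) T 0 with hQ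
  have hsq : blockOp (defectOp T) 0 0 (defectOp (adjoint T)) *
      blockOp (defectOp T) 0 0 (defectOp (adjoint T)) = 1 - Q * Q := by
    ext v : 1
    apply WithLp.ofLp_injective
    refine Prod.ext ?_ ?_
    · change defectOp T (defectOp T v.fst + 0) + 0 =
        v.fst - (0 + adjoint T (T v.fst + 0))
      simp [defectOp_defectOp hT]
    · change 0 + defectOp (adjoint T) (0 + defectOp (adjoint T) v.snd) =
        v.snd - (T (0 + adjoint T v.snd) + 0)
      simp [defectOp_defectOp (norm_adjoint_le_one hT)]
  have hpos : (0 : WithLp 2 (E × F) →L[ℂ] WithLp 2 (E × F)) ≤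
      blockOp (defectOp T) 0 0 (defectOp (adjoint T)) :=
    (ContinuousLinearMap.nonneg_iff_isPositive _).2
      (isPositive_blockOp_diag (isPositive_defectOp T) (isPositive_defectOp _))
  have hsqrt := CFC.sqrt_unique hsq hpos
  have hcomm : Commute (CFC.sqrt (1 - Q * Q)) Q := by
    have h : Commute (1 - Q * Q) Q :=
      (Commute.one_left Q).sub_left ((Commute.refl Q).mul_left (Commute.refl Q))
    rw [CFC.sqrt]
    exact Commute.cfcₙ_nnreal h _
  rw [hsqrt] at hcomm
  have h := DFunLike.congr_fun hcomm.eq (WithLp.toLp 2 (x, 0))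
  have h2 := congrArg WithLp.snd h
  change 0 + defectOp (adjoint T) (T x + 0) = T (defectOp T x + 0) + 0 at h2
  simpa using h2.symm

theorem defectOp_mem (T : E →L[ℂ] F) (x : E) : defectOp T x ∈ defectSpace T :=
  Submodule.le_topologicalClosure _ ⟨x, rfl⟩

theorem orthogonal_defectSpace (T : E →L[ℂ] F) : (defectSpace T)ᗮ = defectKer T := by
  rw [defectSpace, Submodule.orthogonal_closure]
  rw [ContinuousLinearMap.orthogonal_range, (isSelfAdjoint_defectOp T).adjoint_eq]
  rfl

theorem eq_zero_of_mem_defectSpace {T : E →L[ℂ] F} {x : E} (hx : x ∈ defectSpace T)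
    (h : defectOp T x = 0) : x = 0 := by
  have h2 : x ∈ (defectSpace T)ᗮ := by rwa [orthogonal_defectSpace]
  exact inner_self_eq_zero.1 (h2 x hx)

/-- By `T D_T = D_{T^*} T`, a contraction `T` maps `𝔇_T` into `𝔇_{T^*}`. -/
theorem map_mem_defectSpace {T : E →L[ℂ] F} (hT : ‖T‖ ≤ 1) {x : E} (hx : x ∈ defectSpace T) :
    T x ∈ defectSpace (adjoint T) := by
  have h : defectSpace T ≤ (defectSpace (adjoint T)).comap (T : E →ₗ[ℂ] F) := by
    refine Submodule.topologicalClosure_minimal _ ?_ ?_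
    · rintro _ ⟨y, rfl⟩
      change T (defectOp T y) ∈ defectSpace (adjoint T)
      rw [map_defectOp hT]
      exact defectOp_mem _ _
    · exact IsClosed.preimage T.continuous
        (Submodule.isClosed_topologicalClosure _ : IsClosed (defectSpace (adjoint T) : Set F))
  exact h hx

/-- `D_T` is injective on `𝔇_T`, so a solution `K` of `D_T K = S` with values in `𝔇_T` is unique and
hence equal to the chosen one. -/
theorem defectInvComp_eq {T : E →L[ℂ] F} {S : G →L[ℂ] E} {K : G →L[ℂ] defectSpace T}
    (hK : ∀ x, defectOp T (K x : E) = S x) : defectInvComp T S = K := by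
  have h : ∃ K : G →L[ℂ] defectSpace T, ∀ x, defectOp T (K x : E) = S x := ⟨K, hK⟩
  rw [defectInvComp, dif_pos h]
  ext x : 1
  rw [← sub_eq_zero]
  refine Subtype.ext (eq_zero_of_mem_defectSpace (h.choose x - K x).2 ?_)
  rw [Submodule.coe_sub, map_sub, h.choose_spec, hK, sub_self]

end DefectOperators

/-! ### Transfer functions -/

namespace LinSys

section Transfer

variable {M N H : Type*}
  [NormedAddCommGroup M] [InnerProductSpace ℂ M] [NormedAddCommGroup N] [InnerProductSpace ℂ N]
  [NormedAddCommGroup H] [InnerProductSpace ℂ H] {τ : LinSys M N H}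

/-- The state `g = (I - z A)^{-1} B x` satisfies `U (x, z g) = (Θ(z) x, g)`. -/
theorem exists_colligation_eq_transfer {z : ℂ} (hz : IsUnit (1 - z • τ.A)) (x : M) :
    ∃ g : H, τ.colligation (WithLp.toLp 2 (x, z • g)) = WithLp.toLp 2 (τ.transfer z x, g) := by
  refine ⟨Ring.inverse (1 - z • τ.A) (τ.B x), ?_⟩
  have h1 := DFunLike.congr_fun (Ring.mul_inverse_cancel _ hz) (τ.B x)
  change Ring.inverse (1 - z • τ.A) (τ.B x) -
    z • τ.A (Ring.inverse (1 - z • τ.A) (τ.B x)) = τ.B x at h1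
  change WithLp.toLp 2 (τ.D x + τ.C (z • Ring.inverse (1 - z • τ.A) (τ.B x)),
    τ.B x + τ.A (z • Ring.inverse (1 - z • τ.A) (τ.B x))) = WithLp.toLp 2
      (τ.D x + z • τ.C (Ring.inverse (1 - z • τ.A) (τ.B x)), _)
  rw [map_smul, map_smul, ← eq_add_of_sub_eq h1]

/-- The equation `U (x, z g) = (y, g)` determines `y` as `Θ(z) x`. -/
theorem transfer_eq_of_colligation_eq {z : ℂ} (hz : IsUnit (1 - z • τ.A)) {x : M} {y : N} {g : H}
    (hg : τ.colligation (WithLp.toLp 2 (x, z • g)) = WithLp.toLp 2 (y, g)) :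
    τ.transfer z x = y := by
  have h1 : τ.D x + τ.C (z • g) = y := congrArg WithLp.fst hg
  have h2 : τ.B x + τ.A (z • g) = g := congrArg WithLp.snd hg
  have h3 : τ.B x = (1 - z • τ.A) g := by
    change _ = g - z • τ.A g
    rw [← map_smul]
    exact eq_sub_of_add_eq h2
  change τ.D x + z • τ.C (Ring.inverse (1 - z • τ.A) (τ.B x)) = y
  rw [h3, ← mul_apply_eq_comp, Ring.inverse_mul_cancel _ hz,
    one_apply_eq_self, ← map_smul, h1]

theorem transfer_zero (τ : LinSys M N H) : τ.transfer 0 = τ.D := by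
  simp [transfer]

end Transfer

/-! ### Conservative systems -/

section Conservative

variable {M N H : Type*}
  [NormedAddCommGroup M] [InnerProductSpace ℂ M] [CompleteSpace M]
  [NormedAddCommGroup N] [InnerProductSpace ℂ N] [CompleteSpace N]
  [NormedAddCommGroup H] [InnerProductSpace ℂ H] [CompleteSpace H]
  {τ : LinSys M N H}

theorem isConservative_ofColligation {U : WithLp 2 (M × H) →L[ℂ] WithLp 2 (N × H)}
    (e : WithLp 2 (M × H) ≃ₗᵢ[ℂ] WithLp 2 (N × H)) (he : ∀ v, U v = e v) :
    (ofColligation U).IsConservative := by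
  have h1 : adjoint U ∘L U = .id ℂ _ := by
    rw [← ContinuousLinearMap.one_def, ← ContinuousLinearMap.norm_map_iff_adjoint_comp_self]
    intro v
    rw [he, e.norm_map]
  rw [IsConservative, colligation_ofColligation]
  refine ⟨h1, ?_⟩
  ext w : 1
  obtain ⟨v, rfl⟩ := e.surjective w
  have h2 := DFunLike.congr_fun h1 v
  simp only [ContinuousLinearMap.comp_apply, ContinuousLinearMap.id_apply] at h2 ⊢
  rw [← he, h2]

/-- The adjoint system, whose block operator is the adjoint of the block operator of `τ`. -/
def dual (τ : LinSys M N H) : LinSys N M H where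
  D := adjoint τ.D
  C := adjoint τ.B
  B := adjoint τ.C
  A := adjoint τ.A

theorem colligation_dual (τ : LinSys M N H) : τ.dual.colligation = adjoint τ.colligation := by
  rw [ContinuousLinearMap.eq_adjoint_iff]
  intro v w
  simp only [colligation, dual, WithLp.prod_inner_apply, blockOp, ContinuousLinearMap.comp_apply]
  change ⟪adjoint τ.D v.fst + adjoint τ.B v.snd, w.fst⟫_ℂ +
      ⟪adjoint τ.C v.fst + adjoint τ.A v.snd, w.snd⟫_ℂ =
    ⟪v.fst, τ.D w.fst + τ.C w.snd⟫_ℂ + ⟪v.snd, τ.B w.fst + τ.A w.snd⟫_ℂ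
  simp only [inner_add_left, inner_add_right, ContinuousLinearMap.adjoint_inner_left]
  ring

theorem IsConservative.dual (h : τ.IsConservative) : τ.dual.IsConservative := by
  rw [IsConservative, colligation_dual, ContinuousLinearMap.adjoint_adjoint]
  exact ⟨h.2, h.1⟩

theorem IsConservative.norm_sq (h : τ.IsConservative) (x : M) (g : H) :
    ‖τ.D x + τ.C g‖ ^ 2 + ‖τ.B x + τ.A g‖ ^ 2 = ‖x‖ ^ 2 + ‖g‖ ^ 2 := by
  have h1 := h.1
  rw [← ContinuousLinearMap.one_def, ← ContinuousLinearMap.norm_map_iff_adjoint_comp_self] at h1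
  have h2 := congrArg (· ^ 2) (h1 (WithLp.toLp 2 (x, g)))
  simp only [WithLp.prod_norm_sq_eq_of_L2] at h2
  exact h2

theorem IsConservative.norm_sq_state (h : τ.IsConservative) (g : H) :
    ‖τ.C g‖ ^ 2 + ‖τ.A g‖ ^ 2 = ‖g‖ ^ 2 := by
  simpa using h.norm_sq 0 g

theorem IsConservative.norm_A_le (h : τ.IsConservative) : ‖τ.A‖ ≤ 1 := by
  refine ContinuousLinearMap.opNorm_le_bound _ zero_le_one fun g => ?_
  rw [one_mul]
  refine le_of_sq_le_sq ?_ (norm_nonneg _)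
  rw [← h.norm_sq_state g]
  exact le_add_of_nonneg_left (sq_nonneg _)

/-- For a conservative system `ker D_A = ker C`. -/
theorem IsConservative.mem_defectKer_A (h : τ.IsConservative) (g : H) :
    g ∈ defectKer τ.A ↔ τ.C g = 0 := by
  rw [mem_defectKer_iff_norm h.norm_A_le, ← h.norm_sq_state g, right_eq_add, sq_eq_zero_iff,
    norm_eq_zero]

/-- For a conservative system `ker D_{A^*} = ker B^*`. -/
theorem IsConservative.mem_defectKer_adjoint_A (h : τ.IsConservative) (g : H) :
    g ∈ defectKer (adjoint τ.A) ↔ adjoint τ.B g = 0 :=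
  h.dual.mem_defectKer_A g

theorem IsConservative.B_adjoint_B_add (h : τ.IsConservative) (g : H) :
    τ.B (adjoint τ.B g) + τ.A (adjoint τ.A g) = g := by
  have h1 := DFunLike.congr_fun h.2 (WithLp.toLp 2 (0, g))
  rw [← colligation_dual] at h1
  have h2 := congrArg WithLp.snd h1
  change τ.B (adjoint τ.D 0 + adjoint τ.B g) + τ.A (adjoint τ.C 0 + adjoint τ.A g) = g at h2
  simpa using h2

theorem IsConservative.D_adjoint_B_add (h : τ.IsConservative) (g : H) :
    τ.D (adjoint τ.B g) + τ.C (adjoint τ.A g) = 0 := by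
  have h1 := DFunLike.congr_fun h.2 (WithLp.toLp 2 (0, g))
  rw [← colligation_dual] at h1
  have h2 := congrArg WithLp.fst h1
  change τ.D (adjoint τ.D 0 + adjoint τ.B g) + τ.C (adjoint τ.C 0 + adjoint τ.A g) = 0 at h2
  simpa using h2

/-! ### A criterion for simplicity -/

/-- `S` is a set of states that `U` maps onto itself without input and without output: every
trajectory of the system through a state of `S` can be continued in both directions inside `S`, with
zero input and zero output. -/
def IsHidden (U : WithLp 2 (M × H) →L[ℂ] WithLp 2 (N × H)) (S : Set H) : Prop :=
  (∀ h ∈ S, ∃ h' ∈ S, U (WithLp.toLp 2 (0, h)) = WithLp.toLp 2 (0, h')) ∧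
    ∀ h ∈ S, ∃ h' ∈ S, U (WithLp.toLp 2 (0, h')) = WithLp.toLp 2 (0, h)

/-- The orthogonal complement of the controllable and observable states of a conservative system is
hidden. Hence the system is simple as soon as its only hidden states are `0`. -/
theorem IsConservative.isSimple (h : τ.IsConservative)
    (h0 : ∀ S : Set H, IsHidden τ.colligation S → ∀ g ∈ S, g = 0) : τ.IsSimple := by
  rw [IsSimple, Submodule.topologicalClosure_eq_top_iff, eq_bot_iff]
  -- the orthogonal complement of the span, described by `B^* A^{*k} g = 0` and `C A^k g = 0`
  set S : Set H := {g | (∀ k, adjoint τ.B ((adjoint τ.A ^ k) g) = 0) ∧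
    ∀ k, τ.C ((τ.A ^ k) g) = 0} with hS
  have hA : ∀ g, τ.C g = 0 → adjoint τ.A (τ.A g) = g ∧ adjoint τ.B (τ.A g) = 0 := by
    intro g hg
    have h1 := h.dual.B_adjoint_B_add g
    have h2 := h.dual.D_adjoint_B_add g
    simp only [LinSys.dual, ContinuousLinearMap.adjoint_adjoint, hg, map_zero, zero_add] at h1 h2
    exact ⟨h1, h2⟩
  have hA' : ∀ g, adjoint τ.B g = 0 → τ.A (adjoint τ.A g) = g ∧ τ.C (adjoint τ.A g) = 0 := by
    intro g hg
    have h1 := h.B_adjoint_B_add g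
    have h2 := h.D_adjoint_B_add g
    simp only [hg, map_zero, zero_add] at h1 h2
    exact ⟨h1, h2⟩
  have hid : IsHidden τ.colligation S := by
    refine ⟨fun g hg => ⟨τ.A g, ⟨fun k => ?_, fun k => ?_⟩, ?_⟩,
      fun g hg => ⟨adjoint τ.A g, ⟨fun k => ?_, fun k => ?_⟩, ?_⟩⟩
    · cases k with
      | zero => exact (hA g (hg.2 0)).2
      | succ k =>
        rw [pow_succ, mul_apply_eq_comp, (hA g (hg.2 0)).1]
        exact hg.1 k
    · have := hg.2 (k + 1)
      rwa [pow_succ] at this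
    · have h3 : τ.C g = 0 := hg.2 0
      change WithLp.toLp 2 (τ.D 0 + τ.C g, τ.B 0 + τ.A g) = _
      rw [h3]
      simp
    · have := hg.1 (k + 1)
      rwa [pow_succ] at this
    · cases k with
      | zero => exact (hA' g (hg.1 0)).2
      | succ k =>
        rw [pow_succ, mul_apply_eq_comp, (hA' g (hg.1 0)).1]
        exact hg.2 k
    · change WithLp.toLp 2 (τ.D 0 + τ.C (adjoint τ.A g), τ.B 0 + τ.A (adjoint τ.A g)) = _
      rw [(hA' g (hg.1 0)).1, (hA' g (hg.1 0)).2]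
      simp
  intro g hg
  have hpow : ∀ (T : H →L[ℂ] H) (k : ℕ), adjoint (T ^ k) = adjoint T ^ k := fun T k => by
    rw [← ContinuousLinearMap.star_eq_adjoint, star_pow, ContinuousLinearMap.star_eq_adjoint]
  refine h0 S hid g ⟨fun k => ?_, fun k => ?_⟩
  · refine ext_inner_left ℂ fun x => ?_
    rw [inner_zero_right, ContinuousLinearMap.adjoint_inner_right, ← hpow,
      ContinuousLinearMap.adjoint_inner_right]
    exact hg _ (Submodule.subset_span (Or.inl ⟨k, x, rfl⟩))
  · refine ext_inner_left ℂ fun y => ?_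
    rw [inner_zero_right, ← ContinuousLinearMap.adjoint_inner_left,
      ← ContinuousLinearMap.adjoint_inner_left, hpow]
    exact hg _ (Submodule.subset_span (Or.inr ⟨k, y, rfl⟩))

/-! ### Transfer functions of conservative systems -/

theorem isUnit_one_sub_smul {A : H →L[ℂ] H} (hA : ‖A‖ ≤ 1) {z : ℂ}
    (hz : z ∈ Metric.ball (0 : ℂ) 1) : IsUnit (1 - z • A) := by
  refine isUnit_one_sub_of_norm_lt_one ?_
  rw [mem_ball_zero_iff] at hz
  rw [norm_smul]
  nlinarith [norm_nonneg z, norm_nonneg A]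

/-- The transfer function of a conservative system belongs to the Schur class: unitarity of the
block operator gives `‖x‖² - ‖Θ(z) x‖² = (1 - |z|²) ‖g‖²` with `g = (I - z A)^{-1} B x`. -/
theorem IsConservative.schurClass_transfer (h : τ.IsConservative) : SchurClass τ.transfer := by
  refine ⟨fun z hz => ?_, fun z hz => ?_⟩
  · have hu := isUnit_one_sub_smul h.norm_A_le hz
    have h1 : DifferentiableAt ℂ (fun z : ℂ => 1 - z • τ.A) z := by fun_prop
    have h2 : DifferentiableAt ℂ (fun z : ℂ => Ring.inverse (1 - z • τ.A)) z :=
      h1.inverse hu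
    refine DifferentiableAt.differentiableWithinAt ?_
    unfold transfer
    fun_prop
  · refine ContinuousLinearMap.opNorm_le_bound _ zero_le_one fun x => ?_
    rw [one_mul]
    obtain ⟨g, hg⟩ := exists_colligation_eq_transfer (isUnit_one_sub_smul h.norm_A_le hz) x
    have h1 : τ.D x + τ.C (z • g) = τ.transfer z x := congrArg WithLp.fst hg
    have h2 : τ.B x + τ.A (z • g) = g := congrArg WithLp.snd hg
    have h3 := h.norm_sq x (z • g)
    rw [h1, h2, norm_smul, mul_pow] at h3
    refine le_of_sq_le_sq ?_ (norm_nonneg _)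
    have h4 : ‖z‖ ^ 2 ≤ 1 := pow_le_one₀ (norm_nonneg _) (mem_ball_zero_iff.1 hz).le
    nlinarith [sq_nonneg ‖g‖]

end Conservative

end LinSys

/-! ### Defect operators of a conservative system -/

section Omega

/-- An isometry as a unitary operator onto its range. -/
def rangeEquiv {E F : Type*} [NormedAddCommGroup E] [InnerProductSpace ℂ E]
    [NormedAddCommGroup F] [InnerProductSpace ℂ F] (i : E →ₗᵢ[ℂ] F) {S : Submodule ℂ F}
    (h : LinearMap.range i.toLinearMap = S) : E ≃ₗᵢ[ℂ] S :=
  i.equivRange.trans (LinearIsometryEquiv.ofEq _ _ h)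

/-- If `C = D_{Γ^*} Z` with values of `Z` in `𝔇_{Γ^*}`, then `D_{Γ^*}^{-1} C = Z`. -/
theorem defectInvComp_C {M N H Y : Type*} [NormedAddCommGroup M] [InnerProductSpace ℂ M]
    [CompleteSpace M] [NormedAddCommGroup N] [InnerProductSpace ℂ N] [CompleteSpace N]
    [NormedAddCommGroup H] [InnerProductSpace ℂ H] [NormedAddCommGroup Y] [InnerProductSpace ℂ Y]
    {τ : LinSys M N H} {j : Y →ₗᵢ[ℂ] N} {Z : H →L[ℂ] Y}
    (hj : LinearMap.range j.toLinearMap = defectSpace (adjoint τ.D))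
    (hC : ∀ h, τ.C h = defectOp (adjoint τ.D) (j (Z h))) (h : H) :
    defectInvComp (adjoint τ.D) τ.C h = rangeEquiv j hj (Z h) := by
  rw [defectInvComp_eq
    (K := (rangeEquiv j hj).toContinuousLinearEquiv.toContinuousLinearMap ∘L Z)]
  · rfl
  · intro x
    exact (hC x).symm

variable {M N H X : Type*}
  [NormedAddCommGroup M] [InnerProductSpace ℂ M] [CompleteSpace M]
  [NormedAddCommGroup N] [InnerProductSpace ℂ N] [CompleteSpace N]
  [NormedAddCommGroup H] [InnerProductSpace ℂ H] [CompleteSpace H]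
  [NormedAddCommGroup X] [InnerProductSpace ℂ X] [CompleteSpace X]
  {τ : LinSys M N H} {i : X →ₗᵢ[ℂ] M} {W : X →ₗᵢ[ℂ] H}

theorem adjoint_isometry_apply (i : X →ₗᵢ[ℂ] M) (x : X) :
    adjoint i.toContinuousLinearMap (i x) = x := by
  refine ext_inner_left ℂ fun y => ?_
  rw [ContinuousLinearMap.adjoint_inner_right]
  exact i.inner_map_map _ _

/-- `i i^*` is the orthogonal projection onto the range of the isometry `i`. -/
theorem isometry_adjoint_apply {i : X →ₗᵢ[ℂ] M} {S : Submodule ℂ M}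
    (hi : LinearMap.range i.toLinearMap = S) {x : M} (hx : x ∈ S) :
    i (adjoint i.toContinuousLinearMap x) = x := by
  subst hi
  obtain ⟨y, rfl⟩ := hx
  exact congrArg i (adjoint_isometry_apply i y)

/-- If `B = W D_Γ`, then `D_Γ^{-1} B^* = W^*`. -/
theorem defectOp_adjoint_W (hi : LinearMap.range i.toLinearMap = defectSpace τ.D)
    (hB : ∀ x ξ, i ξ = defectOp τ.D x → τ.B x = W ξ) (h : H) :
    defectOp τ.D (i (adjoint W.toContinuousLinearMap h)) = adjoint τ.B h := by
  refine ext_inner_left ℂ fun x => ?_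
  rw [ContinuousLinearMap.adjoint_inner_right,
    hB x _ (isometry_adjoint_apply hi (defectOp_mem _ _)), ← inner_defectOp_left]
  nth_rewrite 1 [← isometry_adjoint_apply hi (defectOp_mem τ.D x)]
  rw [i.inner_map_map, ContinuousLinearMap.adjoint_inner_right]
  rfl

/-- If `B = W D_Γ`, then `(D_Γ^{-1} B^*)^* = W`. -/
theorem adjoint_defectInvComp_B (hi : LinearMap.range i.toLinearMap = defectSpace τ.D)
    (hB : ∀ x ξ, i ξ = defectOp τ.D x → τ.B x = W ξ) (ξ : X) :
    adjoint (defectInvComp τ.D (adjoint τ.B)) (rangeEquiv i hi ξ) = W ξ := by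
  rw [defectInvComp_eq (K := (rangeEquiv i hi).toContinuousLinearEquiv.toContinuousLinearMap ∘L
    adjoint W.toContinuousLinearMap)]
  · refine ext_inner_right ℂ fun h => ?_
    rw [ContinuousLinearMap.adjoint_inner_left]
    change ⟪rangeEquiv i hi ξ, rangeEquiv i hi (adjoint W.toContinuousLinearMap h)⟫_ℂ = _
    rw [LinearIsometryEquiv.inner_map_map, ContinuousLinearMap.adjoint_inner_right]
    rfl
  · exact defectOp_adjoint_W hi hB

/-- For a conservative system with `B = W D_Γ`, `W` an isometry of `𝔇_Γ`, the operator `D_{A^*}` is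
zero on the orthogonal complement of the range of `W`, and on that range it corresponds, through `W`,
to the restriction of `D_Γ` to `𝔇_Γ`; indeed `D_{A^*}^2 = B B^*`. -/
theorem defectOp_adjoint_A (hτ : τ.IsConservative)
    (hi : LinearMap.range i.toLinearMap = defectSpace τ.D)
    (hB : ∀ x ξ, i ξ = defectOp τ.D x → τ.B x = W ξ) :
    defectOp (adjoint τ.A) = (W.toContinuousLinearMap ∘L adjoint i.toContinuousLinearMap) ∘L
      defectOp τ.D ∘L adjoint (W.toContinuousLinearMap ∘L adjoint i.toContinuousLinearMap) := by
  refine defectOp_eq ((isPositive_defectOp τ.D).conj_adjoint _) fun h => ?_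
  simp only [ContinuousLinearMap.adjoint_comp, ContinuousLinearMap.adjoint_adjoint,
    ContinuousLinearMap.comp_apply, LinearIsometry.coe_toContinuousLinearMap]
  rw [adjoint_isometry_apply, isometry_adjoint_apply hi (defectOp_mem _ _),
    ← hB _ _ (isometry_adjoint_apply hi (defectOp_mem _ _)), defectOp_adjoint_W hi hB]
  exact eq_sub_of_add_eq (hτ.B_adjoint_B_add h)

/-- If `B = W D_Γ`, then `D_{A^*}^{-1} B ↾ 𝔇_Γ = W`. -/
theorem defectInvComp_B (hτ : τ.IsConservative)
    (hi : LinearMap.range i.toLinearMap = defectSpace τ.D)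
    (hB : ∀ x ξ, i ξ = defectOp τ.D x → τ.B x = W ξ) (ξ : X) :
    (defectInvComp (adjoint τ.A) τ.B (i ξ) : H) = W ξ := by
  have hmem : ∀ x, (W.toContinuousLinearMap ∘L adjoint i.toContinuousLinearMap) x ∈
      defectSpace (adjoint τ.A) := by
    intro x
    have hc : IsClosed (defectSpace (adjoint τ.A) : Set H) :=
      Submodule.isClosed_topologicalClosure _
    rw [← hc.submodule_topologicalClosure_eq, ← Submodule.orthogonal_orthogonal_eq_closure,
      orthogonal_defectSpace]
    intro h hh
    -- `h ∈ ker D_{A^*} = ker B^*` gives `D_Γ W^* h = 0`, so `W^* h = 0`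
    rw [hτ.mem_defectKer_adjoint_A, ← defectOp_adjoint_W hi hB] at hh
    have h1 : i (adjoint W.toContinuousLinearMap h) = 0 :=
      eq_zero_of_mem_defectSpace (hi ▸ LinearMap.mem_range_self i.toLinearMap _) hh
    have h2 : adjoint W.toContinuousLinearMap h = 0 := i.injective (h1.trans (map_zero i).symm)
    change ⟪h, W.toContinuousLinearMap (adjoint i.toContinuousLinearMap x)⟫_ℂ = 0
    rw [← ContinuousLinearMap.adjoint_inner_left, h2, inner_zero_left]
  rw [defectInvComp_eq (K := (W.toContinuousLinearMap ∘L
    adjoint i.toContinuousLinearMap).codRestrict _ hmem)]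
  · exact congrArg W (adjoint_isometry_apply i ξ)
  · intro x
    rw [defectOp_adjoint_A hτ hi hB, hB x _ (isometry_adjoint_apply hi (defectOp_mem _ _))]
    simp only [ContinuousLinearMap.adjoint_comp, ContinuousLinearMap.adjoint_adjoint,
      ContinuousLinearMap.comp_apply, LinearIsometry.coe_toContinuousLinearMap,
      ContinuousLinearMap.coe_codRestrict_apply]
    rw [adjoint_isometry_apply]
    congr 2
    -- `D_Γ` vanishes on the orthogonal complement of its range
    refine ext_inner_left ℂ fun y => ?_
    rw [← inner_defectOp_left, ← inner_defectOp_left]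
    nth_rewrite 1 [← isometry_adjoint_apply hi (defectOp_mem τ.D y)]
    rw [i.inner_map_map, ContinuousLinearMap.adjoint_inner_right,
      LinearIsometry.coe_toContinuousLinearMap, isometry_adjoint_apply hi (defectOp_mem τ.D y)]

end Omega

/-! ### Unitarity of the CMV matrices -/

section UnitarySums

/-- The orthogonal sum of a sequence of unitary operators. -/
def diagEquiv {E F : ℕ → Type*}
    [∀ n, NormedAddCommGroup (E n)] [∀ n, InnerProductSpace ℂ (E n)]
    [∀ n, NormedAddCommGroup (F n)] [∀ n, InnerProductSpace ℂ (F n)]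
    (e : ∀ n, E n ≃ₗᵢ[ℂ] F n) : lp E 2 ≃ₗᵢ[ℂ] lp F 2 where
  toFun f := ⟨fun n => e n (f n), memℓp_two (by simpa using summable_sq_norm f)⟩
  invFun g := ⟨fun n => (e n).symm (g n), memℓp_two (by simpa using summable_sq_norm g)⟩
  map_add' f g := by
    ext n
    exact map_add (e n) (f n) (g n)
  map_smul' c f := by
    ext n
    exact map_smul (e n) c (f n)
  left_inv f := by
    ext n
    exact (e n).symm_apply_apply (f n)
  right_inv g := by
    ext n
    exact (e n).apply_symm_apply (g n)
  norm_map' f := by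
    refine (sq_eq_sq₀ (norm_nonneg _) (norm_nonneg _)).1 ?_
    rw [norm_sq_eq_tsum, norm_sq_eq_tsum]
    exact tsum_congr fun n => congrArg (· ^ 2) ((e n).norm_map (f n))

theorem diagOp_eq_diagEquiv {E F : ℕ → Type*}
    [∀ n, NormedAddCommGroup (E n)] [∀ n, InnerProductSpace ℂ (E n)]
    [∀ n, NormedAddCommGroup (F n)] [∀ n, InnerProductSpace ℂ (F n)]
    {S : ∀ n, E n →L[ℂ] F n} {c : ℝ} {hS : ∀ n, ‖S n‖ ≤ c} {e : ∀ n, E n ≃ₗᵢ[ℂ] F n}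
    (h : ∀ n v, S n v = e n v) (f : lp E 2) : diagOp S c hS f = diagEquiv e f := by
  ext n
  exact h n (f n)

/-- The unitary operator `I ⊕ e`. -/
def idProdEquiv (E : Type*) {F G : Type*} [NormedAddCommGroup E] [InnerProductSpace ℂ E]
    [NormedAddCommGroup F] [InnerProductSpace ℂ F] [NormedAddCommGroup G] [InnerProductSpace ℂ G]
    (e : F ≃ₗᵢ[ℂ] G) : WithLp 2 (E × F) ≃ₗᵢ[ℂ] WithLp 2 (E × G) where
  toFun v := WithLp.toLp 2 (v.fst, e v.snd)
  invFun v := WithLp.toLp 2 (v.fst, e.symm v.snd)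
  map_add' v w := WithLp.ofLp_injective 2 (Prod.ext rfl (map_add e _ _))
  map_smul' c v := WithLp.ofLp_injective 2 (Prod.ext rfl (map_smul e _ _))
  left_inv v := WithLp.ofLp_injective 2 (Prod.ext rfl (e.symm_apply_apply _))
  right_inv v := WithLp.ofLp_injective 2 (Prod.ext rfl (e.apply_symm_apply _))
  norm_map' v := by
    refine (sq_eq_sq₀ (norm_nonneg _) (norm_nonneg _)).1 ?_
    simp [WithLp.prod_norm_sq_eq_of_L2]

end UnitarySums

namespace ChoiceSequence

variable {X Y : ℕ → Type*}
  [∀ n, NormedAddCommGroup (X n)] [∀ n, InnerProductSpace ℂ (X n)] [∀ n, CompleteSpace (X n)]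
  [∀ n, NormedAddCommGroup (Y n)] [∀ n, InnerProductSpace ℂ (Y n)] [∀ n, CompleteSpace (Y n)]
  (Γ : ChoiceSequence X Y)

theorem norm_adjoint_op_le (n : ℕ) : ‖adjoint (Γ.op n)‖ ≤ 1 :=
  norm_adjoint_le_one (Γ.norm_op_le n)

theorem inclX_mem (n : ℕ) (x : X (n + 1)) : Γ.inclX n x ∈ defectSpace (Γ.op n) := by
  rw [← Γ.range_inclX n]
  exact LinearMap.mem_range_self _ x

theorem inclY_mem (n : ℕ) (y : Y (n + 1)) : Γ.inclY n y ∈ defectSpace (adjoint (Γ.op n)) := by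
  rw [← Γ.range_inclY n]
  exact LinearMap.mem_range_self _ y

theorem inclX_defX (n : ℕ) (x : X n) : Γ.inclX n (Γ.defX n x) = defectOp (Γ.op n) x :=
  isometry_adjoint_apply (Γ.range_inclX n) (defectOp_mem _ _)

theorem inclX_adj (n : ℕ) (y : Y (n + 1)) :
    Γ.inclX n (Γ.adj n y) = adjoint (Γ.op n) (Γ.inclY n y) := by
  refine isometry_adjoint_apply (Γ.range_inclX n) ?_
  have h := map_mem_defectSpace (Γ.norm_adjoint_op_le n) (Γ.inclY_mem n y)
  rwa [ContinuousLinearMap.adjoint_adjoint] at h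

theorem adjoint_op_defectOp (n : ℕ) (y : Y n) :
    adjoint (Γ.op n) (defectOp (adjoint (Γ.op n)) y) =
      defectOp (Γ.op n) (adjoint (Γ.op n) y) := by
  rw [map_defectOp (Γ.norm_adjoint_op_le n), ContinuousLinearMap.adjoint_adjoint]

theorem eq_zero_of_defY_eq_zero {n : ℕ} {y : Y (n + 1)} (h : Γ.defY n y = 0) : y = 0 :=
  (Γ.inclY n).injective ((eq_zero_of_mem_defectSpace (Γ.inclY_mem n y) h).trans (map_zero _).symm)

theorem J_toLp (n : ℕ) (x : X n) (y : Y (n + 1)) : Γ.J n (WithLp.toLp 2 (x, y)) =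
    WithLp.toLp 2 (Γ.op n x + Γ.defY n y, Γ.defX n x + -Γ.adj n y) := rfl

/-- The cross terms cancel by `Γ_n D_{Γ_n} = D_{Γ_n^*} Γ_n`. -/
theorem norm_J (n : ℕ) (v : WithLp 2 (X n × Y (n + 1))) : ‖Γ.J n v‖ = ‖v‖ := by
  refine (sq_eq_sq₀ (norm_nonneg _) (norm_nonneg _)).1 ?_
  rw [WithLp.prod_norm_sq_eq_of_L2, WithLp.prod_norm_sq_eq_of_L2, J, blockOp_fst, blockOp_snd,
    ← (Γ.inclX n).norm_map, ← (Γ.inclY n).norm_map v.snd]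
  change ‖Γ.op n v.fst + defectOp (adjoint (Γ.op n)) (Γ.inclY n v.snd)‖ ^ 2 +
    ‖Γ.inclX n (Γ.defX n v.fst + -Γ.adj n v.snd)‖ ^ 2 = _
  rw [map_add, map_neg, inclX_defX, inclX_adj, ← sub_eq_add_neg, @norm_add_sq ℂ, @norm_sub_sq ℂ,
    norm_sq_defectOp (Γ.norm_op_le n), norm_sq_defectOp (Γ.norm_adjoint_op_le n),
    ← inner_defectOp_left, ← map_defectOp (Γ.norm_op_le n),
    ContinuousLinearMap.adjoint_inner_right]
  ring

/-- The preimage of `(y, x)` under `J_{Γ_n}` is `J_{Γ_n^*} (y, x)`. -/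
theorem J_inverse (n : ℕ) (y : Y n) (x : X (n + 1)) :
    Γ.J n (WithLp.toLp 2 (adjoint (Γ.op n) y + defectOp (Γ.op n) (Γ.inclX n x),
      adjoint (Γ.inclY n).toContinuousLinearMap
        (defectOp (adjoint (Γ.op n)) y - Γ.op n (Γ.inclX n x)))) = WithLp.toLp 2 (y, x) := by
  have hmem : defectOp (adjoint (Γ.op n)) y - Γ.op n (Γ.inclX n x) ∈
      defectSpace (adjoint (Γ.op n)) :=
    sub_mem (defectOp_mem _ _) (map_mem_defectSpace (Γ.norm_op_le n) (Γ.inclX_mem n x))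
  have hi := isometry_adjoint_apply (Γ.range_inclY n) hmem
  rw [J_toLp]
  congr 2
  · change _ + defectOp (adjoint (Γ.op n)) (Γ.inclY n _) = y
    rw [hi, map_sub, defectOp_defectOp (Γ.norm_adjoint_op_le n), map_add,
      map_defectOp (Γ.norm_op_le n), ContinuousLinearMap.adjoint_adjoint]
    abel
  · apply (Γ.inclX n).injective
    rw [map_add, map_neg, inclX_defX, inclX_adj, hi, map_sub, adjoint_op_defectOp, map_add,
      defectOp_defectOp (Γ.norm_op_le n)]
    abel

/-- The elementary rotation `J_{Γ_n}` as a unitary operator. -/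
def unitaryJ (n : ℕ) : WithLp 2 (X n × Y (n + 1)) ≃ₗᵢ[ℂ] WithLp 2 (Y n × X (n + 1)) :=
  .ofSurjective ⟨(Γ.J n).toLinearMap, Γ.norm_J n⟩ fun w => ⟨_, Γ.J_inverse n w.fst w.snd⟩

/-- The operator `V_0` as a unitary operator. -/
def unitaryV : Γ.StateSpace ≃ₗᵢ[ℂ] Γ.StateSpaceT := diagEquiv fun n => Γ.unitaryJ (2 * n + 1)

theorem opV_eq (f : Γ.StateSpace) : Γ.opV f = Γ.unitaryV f :=
  diagOp_eq_diagEquiv (fun _ _ => rfl) f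

/-- The operator `L_0` as a unitary operator. -/
def unitaryL : WithLp 2 (X 0 × Γ.StateSpaceT) ≃ₗᵢ[ℂ] WithLp 2 (Y 0 × Γ.StateSpace) :=
  (regroup (fun n => X (2 * n)) (fun n => Y (2 * n + 1))).trans
    ((diagEquiv fun n => Γ.unitaryJ (2 * n)).trans
      (regroup (fun n => Y (2 * n)) (fun n => X (2 * n + 1))).symm)

theorem opL_eq (v : WithLp 2 (X 0 × Γ.StateSpaceT)) : Γ.opL v = Γ.unitaryL v :=
  congrArg (regroup (fun n => Y (2 * n)) (fun n => X (2 * n + 1))).symm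
    (diagOp_eq_diagEquiv (hS := fun n => Γ.J_norm_le (2 * n)) (fun _ _ => rfl) _)

theorem opM_toLp (x : X 0) (f : Γ.StateSpace) :
    Γ.opM (WithLp.toLp 2 (x, f)) = WithLp.toLp 2 (x, Γ.opV f) := by
  change WithLp.toLp 2 (x + 0, 0 + Γ.opV f) = _
  rw [add_zero, zero_add]

theorem opMT_toLp (y : Y 0) (f : Γ.StateSpace) :
    Γ.opMT (WithLp.toLp 2 (y, f)) = WithLp.toLp 2 (y, Γ.opV f) := by
  change WithLp.toLp 2 (y + 0, 0 + Γ.opV f) = _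
  rw [add_zero, zero_add]

theorem isConservative_zeta : Γ.zeta.IsConservative :=
  LinSys.isConservative_ofColligation ((idProdEquiv (X 0) Γ.unitaryV).trans Γ.unitaryL) fun v => by
    change Γ.opL (Γ.opM (WithLp.toLp 2 (v.fst, v.snd))) = _
    rw [opM_toLp, opL_eq, opV_eq]
    rfl

theorem isConservative_zetaT : Γ.zetaT.IsConservative :=
  LinSys.isConservative_ofColligation (Γ.unitaryL.trans (idProdEquiv (Y 0) Γ.unitaryV)) fun v => by
    change Γ.opMT (WithLp.toLp 2 ((Γ.opL v).fst, (Γ.opL v).snd)) = _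
    rw [opMT_toLp, opL_eq, opV_eq]
    rfl

/-! ### Splitting off the first parameter -/

/-- The identification of `𝔇_{Γ_0} ⊕ ℌ̃_0({Γ_n}_{n ≥ 1})` with `ℌ_0`. -/
def glue : WithLp 2 (X 1 × Γ.tail.StateSpaceT) ≃ₗᵢ[ℂ] Γ.StateSpace :=
  regroup (fun n => X (2 * n + 1)) (fun n => Y (2 * (n + 1)))

/-- The identification of `𝔇_{Γ_0^*} ⊕ ℌ_0({Γ_n}_{n ≥ 1})` with `ℌ̃_0`. -/
def glueT : WithLp 2 (Y 1 × Γ.tail.StateSpace) ≃ₗᵢ[ℂ] Γ.StateSpaceT :=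
  regroup (fun n => Y (2 * n + 1)) (fun n => X (2 * (n + 1)))

/-- Up to regrouping, `V_0` is the operator `L_0` of the shifted choice sequence. -/
theorem opV_glue (v : WithLp 2 (X 1 × Γ.tail.StateSpaceT)) :
    Γ.opV (Γ.glue v) = Γ.glueT (Γ.tail.opL v) :=
  ((regroup (fun n => Y (2 * n + 1)) (fun n => X (2 * (n + 1)))).apply_symm_apply _).symm

/-- Up to regrouping, `L_0` is the sum of `J_{Γ_0}` and the operator `V_0` of the shifted choice
sequence. -/
theorem opL_glueT (x : X 0) (y : Y 1) (h : Γ.tail.StateSpace) :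
    Γ.opL (WithLp.toLp 2 (x, Γ.glueT (WithLp.toLp 2 (y, h)))) =
      WithLp.toLp 2 (Γ.op 0 x + Γ.defY 0 y,
        Γ.glue (WithLp.toLp 2 (Γ.defX 0 x - Γ.adj 0 y, Γ.tail.opV h))) := by
  rw [sub_eq_add_neg]
  apply (regroup (fun n => Y (2 * n)) (fun n => X (2 * n + 1))).injective
  refine ((regroup (fun n => Y (2 * n)) (fun n => X (2 * n + 1))).apply_symm_apply _).trans ?_
  ext n
  cases n <;> rfl

/-- The block recursion `U_0({Γ_n}_{n ≥ 0}) = (J_{Γ_0} ⊕ I)(I ⊕ Ũ_0({Γ_n}_{n ≥ 1}))`. -/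
theorem opU_glue (x : X 0) (v : WithLp 2 (X 1 × Γ.tail.StateSpaceT)) :
    Γ.opU (WithLp.toLp 2 (x, Γ.glue v)) =
      WithLp.toLp 2 (Γ.op 0 x + Γ.defY 0 (Γ.tail.opUT v).fst,
        Γ.glue (WithLp.toLp 2 (Γ.defX 0 x - Γ.adj 0 (Γ.tail.opUT v).fst, (Γ.tail.opUT v).snd))) := by
  obtain ⟨y, h, hv⟩ : ∃ y h, Γ.tail.opL v = WithLp.toLp 2 (y, h) := ⟨_, _, rfl⟩
  have h1 : Γ.tail.opUT v = WithLp.toLp 2 (y, Γ.tail.opV h) :=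
    (congrArg Γ.tail.opMT hv).trans (Γ.tail.opMT_toLp y h)
  rw [h1]
  change Γ.opL (Γ.opM (WithLp.toLp 2 (x, Γ.glue v))) = _
  rw [opM_toLp, opV_glue, hv]
  exact Γ.opL_glueT x y h

/-- The block recursion `Ũ_0({Γ_n}_{n ≥ 0}) = (I ⊕ U_0({Γ_n}_{n ≥ 1}))(J_{Γ_0} ⊕ I)`. -/
theorem opUT_glueT (x : X 0) (y : Y 1) (h : Γ.tail.StateSpace) :
    Γ.opUT (WithLp.toLp 2 (x, Γ.glueT (WithLp.toLp 2 (y, h)))) =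
      WithLp.toLp 2 (Γ.op 0 x + Γ.defY 0 y,
        Γ.glueT (Γ.tail.opU (WithLp.toLp 2 (Γ.defX 0 x - Γ.adj 0 y, h)))) := by
  change Γ.opMT (Γ.opL _) = _
  rw [opL_glueT, opMT_toLp, opV_glue]
  exact congrArg (fun k => WithLp.toLp 2 (Γ.op 0 x + Γ.defY 0 y, Γ.glueT (Γ.tail.opL k)))
    (Γ.tail.opM_toLp _ h).symm

end ChoiceSequence

/-! ### Components with respect to a unitary decomposition -/

section Components

variable {E F H : Type*} [NormedAddCommGroup E] [InnerProductSpace ℂ E]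
  [NormedAddCommGroup F] [InnerProductSpace ℂ F] [NormedAddCommGroup H] [InnerProductSpace ℂ H]

/-- The embedding of the first summand given by a unitary operator `e : E ⊕ F → H`. -/
def inlIsometry (e : WithLp 2 (E × F) ≃ₗᵢ[ℂ] H) : E →ₗᵢ[ℂ] H where
  toFun x := e (WithLp.toLp 2 (x, 0))
  map_add' x y := by
    rw [← map_add]
    exact congrArg e (WithLp.ofLp_injective 2 (Prod.ext rfl (add_zero 0).symm))
  map_smul' c x := by
    rw [← map_smul]
    exact congrArg e (WithLp.ofLp_injective 2 (Prod.ext rfl (smul_zero c).symm))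
  norm_map' x := by
    refine (e.norm_map _).trans ((sq_eq_sq₀ (norm_nonneg _) (norm_nonneg _)).1 ?_)
    simp

/-- The embedding of the second summand given by a unitary operator `e : E ⊕ F → H`. -/
def inrIsometry (e : WithLp 2 (E × F) ≃ₗᵢ[ℂ] H) : F →ₗᵢ[ℂ] H where
  toFun y := e (WithLp.toLp 2 (0, y))
  map_add' x y := by
    rw [← map_add]
    exact congrArg e (WithLp.ofLp_injective 2 (Prod.ext (add_zero 0).symm rfl))
  map_smul' c x := by
    rw [← map_smul]
    exact congrArg e (WithLp.ofLp_injective 2 (Prod.ext (smul_zero c).symm rfl))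
  norm_map' x := by
    refine (e.norm_map _).trans ((sq_eq_sq₀ (norm_nonneg _) (norm_nonneg _)).1 ?_)
    simp

theorem inlIsometry_apply (e : WithLp 2 (E × F) ≃ₗᵢ[ℂ] H) (x : E) :
    inlIsometry e x = e (WithLp.toLp 2 (x, 0)) := rfl

theorem range_inrIsometry (e : WithLp 2 (E × F) ≃ₗᵢ[ℂ] H) {K : Submodule ℂ H}
    (hK : ∀ h, h ∈ K ↔ (e.symm h).fst = 0) :
    LinearMap.range (inrIsometry e).toLinearMap = K := by
  ext h
  rw [hK]
  constructor
  · rintro ⟨y, rfl⟩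
    change (e.symm (e _)).fst = 0
    rw [e.symm_apply_apply]
    rfl
  · intro h0
    refine ⟨(e.symm h).snd, ?_⟩
    change e (WithLp.toLp 2 (0, (e.symm h).snd)) = h
    rw [← h0]
    exact e.apply_symm_apply h

theorem adjoint_inlIsometry [CompleteSpace E] [CompleteSpace H] (e : WithLp 2 (E × F) ≃ₗᵢ[ℂ] H)
    (h : H) : adjoint (inlIsometry e).toContinuousLinearMap h = (e.symm h).fst := by
  refine ext_inner_left ℂ fun x => ?_
  rw [ContinuousLinearMap.adjoint_inner_right]
  change ⟪e (WithLp.toLp 2 (x, 0)), h⟫_ℂ = _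
  rw [e.inner_map_eq_flip]
  simp

/-- The orthogonal projection onto the second summand of `e : E ⊕ F → H`. -/
theorem projection_apply (e : WithLp 2 (E × F) ≃ₗᵢ[ℂ] H) {K : Submodule ℂ H}
    [K.HasOrthogonalProjection] (hK : ∀ h, h ∈ K ↔ (e.symm h).fst = 0) (v : WithLp 2 (E × F)) :
    (K.orthogonalProjectionOnto (e v) : H) = e (WithLp.toLp 2 (0, v.snd)) := by
  refine Submodule.eq_starProjection_of_mem_of_inner_eq_zero ((hK _).2 ?_) ?_
  · rw [e.symm_apply_apply]
    rfl
  · intro w hw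
    rw [← map_sub, e.inner_map_eq_flip, WithLp.prod_inner_apply]
    simp [(hK w).1 hw]

end Components

/-- For a conservative system with `B = W D_Γ`, the kernel of `D_{A^*}` is the orthogonal complement of
the range of `W`. -/
theorem LinSys.IsConservative.mem_defectKer_adjoint_A_iff {M N H X : Type*}
    [NormedAddCommGroup M] [InnerProductSpace ℂ M] [CompleteSpace M]
    [NormedAddCommGroup N] [InnerProductSpace ℂ N] [CompleteSpace N]
    [NormedAddCommGroup H] [InnerProductSpace ℂ H] [CompleteSpace H]
    [NormedAddCommGroup X] [InnerProductSpace ℂ X] [CompleteSpace X]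
    {τ : LinSys M N H} {i : X →ₗᵢ[ℂ] M} {W : X →ₗᵢ[ℂ] H} (hτ : τ.IsConservative)
    (hi : LinearMap.range i.toLinearMap = defectSpace τ.D)
    (hB : ∀ x ξ, i ξ = defectOp τ.D x → τ.B x = W ξ) (h : H) :
    h ∈ defectKer (adjoint τ.A) ↔ adjoint W.toContinuousLinearMap h = 0 := by
  rw [hτ.mem_defectKer_adjoint_A, ← defectOp_adjoint_W hi hB]
  refine ⟨fun h0 => i.injective ?_, fun h0 => by rw [h0, map_zero, map_zero]⟩
  rw [map_zero]
  exact eq_zero_of_mem_defectSpace (hi ▸ LinearMap.mem_range_self i.toLinearMap _) h0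

namespace ChoiceSequence

variable {X Y : ℕ → Type*}
  [∀ n, NormedAddCommGroup (X n)] [∀ n, InnerProductSpace ℂ (X n)] [∀ n, CompleteSpace (X n)]
  [∀ n, NormedAddCommGroup (Y n)] [∀ n, InnerProductSpace ℂ (Y n)] [∀ n, CompleteSpace (Y n)]
  (Γ : ChoiceSequence X Y)

/-! ### Unitary equivalence of the two systems -/

theorem colligation_zeta : Γ.zeta.colligation = Γ.opU := LinSys.colligation_ofColligation _

theorem colligation_zetaT : Γ.zetaT.colligation = Γ.opUT := LinSys.colligation_ofColligation _

theorem opU_toLp (x : X 0) (f : Γ.StateSpace) :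
    Γ.opU (WithLp.toLp 2 (x, f)) = Γ.opL (WithLp.toLp 2 (x, Γ.opV f)) :=
  congrArg Γ.opL (Γ.opM_toLp x f)

theorem opUT_eq (v : WithLp 2 (X 0 × Γ.StateSpaceT)) :
    Γ.opUT v = WithLp.toLp 2 ((Γ.opL v).fst, Γ.opV (Γ.opL v).snd) :=
  Γ.opMT_toLp (Γ.opL v).fst (Γ.opL v).snd

theorem opUT_opV (x : X 0) (f : Γ.StateSpace) :
    Γ.opUT (WithLp.toLp 2 (x, Γ.opV f)) =
      WithLp.toLp 2 ((Γ.opU (WithLp.toLp 2 (x, f))).fst,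
        Γ.opV (Γ.opU (WithLp.toLp 2 (x, f))).snd) := by
  rw [opUT_eq, opU_toLp]

/-- The equivalence is `V_0`, because `Ũ_0 (I ⊕ V_0) = (I ⊕ V_0) U_0`. -/
theorem unitarilyEquivalent_zeta_zetaT : Γ.zeta.UnitarilyEquivalent Γ.zetaT := by
  have h0 : ∀ x, Γ.opUT (WithLp.toLp 2 (x, 0)) =
      WithLp.toLp 2 ((Γ.opU (WithLp.toLp 2 (x, 0))).fst,
        Γ.opV (Γ.opU (WithLp.toLp 2 (x, 0))).snd) := fun x => by
    have := Γ.opUT_opV x 0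
    rwa [map_zero] at this
  refine ⟨Γ.unitaryV, fun x => ?_, fun f => ?_, fun x => ?_, fun f => ?_⟩
  · exact (congrArg WithLp.fst (h0 x)).symm
  · change (Γ.opU (WithLp.toLp 2 (0, f))).fst = (Γ.opUT (WithLp.toLp 2 (0, Γ.unitaryV f))).fst
    rw [← opV_eq, opUT_opV]
    rfl
  · rw [← opV_eq]
    exact (congrArg WithLp.snd (h0 x)).symm
  · rw [← opV_eq, ← opV_eq]
    exact (congrArg WithLp.snd (Γ.opUT_opV 0 f)).symm

theorem transfer_zeta_eq {z : ℂ} (hz : z ∈ Metric.ball (0 : ℂ) 1) :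
    Γ.zeta.transfer z = Γ.zetaT.transfer z := by
  ext x
  obtain ⟨g, hg⟩ := LinSys.exists_colligation_eq_transfer
    (LinSys.isUnit_one_sub_smul Γ.isConservative_zeta.norm_A_le hz) x
  symm
  refine LinSys.transfer_eq_of_colligation_eq
    (LinSys.isUnit_one_sub_smul Γ.isConservative_zetaT.norm_A_le hz) (g := Γ.opV g) ?_
  rw [colligation_zeta] at hg
  rw [colligation_zetaT, ← map_smul, opUT_opV, hg]
  rfl

/-! ### Simplicity of the two systems -/

variable {Γ} in
/-- A hidden state of `ζ_0` has the form `0 ⊕ k`, with `k` a hidden state of the system `ζ̃_0` of the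
shifted choice sequence. -/
theorem isHidden_opU {S : Set Γ.StateSpace} (hS : LinSys.IsHidden Γ.opU S) :
    (∀ h ∈ S, ∃ k, h = Γ.glue (WithLp.toLp 2 (0, k))) ∧
      LinSys.IsHidden Γ.tail.opUT {k | Γ.glue (WithLp.toLp 2 (0, k)) ∈ S} := by
  have step : ∀ (v : WithLp 2 (X 1 × Γ.tail.StateSpaceT)) (h' : Γ.StateSpace),
      Γ.opU (WithLp.toLp 2 (0, Γ.glue v)) = WithLp.toLp 2 (0, h') →
        (Γ.tail.opUT v).fst = 0 ∧
          h' = Γ.glue (WithLp.toLp 2 (0, (Γ.tail.opUT v).snd)) := by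
    intro v h' h
    rw [opU_glue, map_zero, zero_add, map_zero, zero_sub] at h
    have h1 := Γ.eq_zero_of_defY_eq_zero (congrArg WithLp.fst h)
    refine ⟨h1, ?_⟩
    have h2 : Γ.glue (WithLp.toLp 2 (-Γ.adj 0 (Γ.tail.opUT v).fst, (Γ.tail.opUT v).snd)) = h' :=
      congrArg WithLp.snd h
    rw [← h2, h1, map_zero, neg_zero]
  have form : ∀ h ∈ S, ∃ k, h = Γ.glue (WithLp.toLp 2 (0, k)) := by
    intro h hh
    obtain ⟨h', -, h1⟩ := hS.2 h hh
    obtain ⟨v, rfl⟩ := Γ.glue.surjective h'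
    exact ⟨_, (step v h h1).2⟩
  refine ⟨form, fun k hk => ?_, fun k hk => ?_⟩
  · obtain ⟨h', hh', h1⟩ := hS.1 _ hk
    obtain ⟨h2, rfl⟩ := step _ _ h1
    exact ⟨_, hh', WithLp.ofLp_injective 2 (Prod.ext h2 rfl)⟩
  · obtain ⟨h', hh', h1⟩ := hS.2 _ hk
    obtain ⟨k', rfl⟩ := form h' hh'
    obtain ⟨h2, h3⟩ := step _ _ h1
    refine ⟨k', hh', WithLp.ofLp_injective 2 (Prod.ext h2 ?_)⟩
    exact (congrArg WithLp.snd (Γ.glue.injective h3)).symm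

variable {Γ} in
/-- A hidden state of `ζ̃_0` has the form `0 ⊕ h`, with `h` a hidden state of the system `ζ_0` of the
shifted choice sequence. -/
theorem isHidden_opUT {S : Set Γ.StateSpaceT} (hS : LinSys.IsHidden Γ.opUT S) :
    (∀ g ∈ S, ∃ h, g = Γ.glueT (WithLp.toLp 2 (0, h))) ∧
      LinSys.IsHidden Γ.tail.opU {h | Γ.glueT (WithLp.toLp 2 (0, h)) ∈ S} := by
  have form : ∀ g ∈ S, ∃ h, g = Γ.glueT (WithLp.toLp 2 (0, h)) := by
    intro g hg
    obtain ⟨g', -, h1⟩ := hS.1 g hg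
    obtain ⟨⟨y, h⟩, rfl⟩ := Γ.glueT.surjective g
    rw [opUT_glueT, map_zero, zero_add] at h1
    have h2 : y = 0 := Γ.eq_zero_of_defY_eq_zero (congrArg WithLp.fst h1)
    exact ⟨h, by rw [h2]⟩
  have step : ∀ h g', Γ.opUT (WithLp.toLp 2 (0, Γ.glueT (WithLp.toLp 2 (0, h)))) =
      WithLp.toLp 2 (0, g') → g' = Γ.glueT (Γ.tail.opU (WithLp.toLp 2 (0, h))) := by
    intro h g' h1
    rw [opUT_glueT, map_zero, map_zero, map_zero, map_zero, sub_zero] at h1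
    exact (congrArg WithLp.snd h1).symm
  refine ⟨form, fun h hh => ?_, fun h hh => ?_⟩
  · obtain ⟨g', hg', h1⟩ := hS.1 _ hh
    obtain ⟨h', rfl⟩ := form g' hg'
    exact ⟨h', hg', (Γ.glueT.injective (step _ _ h1)).symm⟩
  · obtain ⟨g', hg', h1⟩ := hS.2 _ hh
    obtain ⟨h', rfl⟩ := form g' hg'
    exact ⟨h', hg', (Γ.glueT.injective (step _ _ h1)).symm⟩

end ChoiceSequence

/-- The coordinates of hidden states vanish: the coordinate `2 n + 1` of a hidden state is, for the
shifted choice sequence, the coordinate `2 n` of a hidden state of the other system, and so on down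
to the coordinate `0`. -/
theorem ChoiceSequence.fst_eq_zero_of_isHidden (n : ℕ) : ∀ {X Y : ℕ → Type*}
    [∀ n, NormedAddCommGroup (X n)] [∀ n, InnerProductSpace ℂ (X n)] [∀ n, CompleteSpace (X n)]
    [∀ n, NormedAddCommGroup (Y n)] [∀ n, InnerProductSpace ℂ (Y n)] [∀ n, CompleteSpace (Y n)]
    (Γ : ChoiceSequence X Y),
    (∀ S, LinSys.IsHidden Γ.opU S → ∀ h ∈ S, (h n).fst = 0) ∧
      (∀ S, LinSys.IsHidden Γ.opUT S → ∀ g ∈ S, (g n).fst = 0) := by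
  induction n with
  | zero =>
    intro X Y _ _ _ _ _ _ Γ
    refine ⟨fun S hS h hh => ?_, fun S hS g hg => ?_⟩
    · obtain ⟨k, rfl⟩ := (isHidden_opU hS).1 h hh
      rfl
    · obtain ⟨k, rfl⟩ := (isHidden_opUT hS).1 g hg
      rfl
  | succ n ih =>
    intro X Y _ _ _ _ _ _ Γ
    refine ⟨fun S hS h hh => ?_, fun S hS g hg => ?_⟩
    · obtain ⟨k, rfl⟩ := (isHidden_opU hS).1 h hh
      obtain ⟨l, rfl⟩ := (isHidden_opUT (isHidden_opU hS).2).1 k hh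
      exact (ih Γ.tail.tail).1 _ (isHidden_opUT (isHidden_opU hS).2).2 l hh
    · obtain ⟨k, rfl⟩ := (isHidden_opUT hS).1 g hg
      obtain ⟨l, rfl⟩ := (isHidden_opU (isHidden_opUT hS).2).1 k hg
      exact (ih Γ.tail.tail).2 _ (isHidden_opU (isHidden_opUT hS).2).2 l hg

namespace ChoiceSequence

variable {X Y : ℕ → Type*}
  [∀ n, NormedAddCommGroup (X n)] [∀ n, InnerProductSpace ℂ (X n)] [∀ n, CompleteSpace (X n)]
  [∀ n, NormedAddCommGroup (Y n)] [∀ n, InnerProductSpace ℂ (Y n)] [∀ n, CompleteSpace (Y n)]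
  (Γ : ChoiceSequence X Y)

theorem isSimple_zeta : Γ.zeta.IsSimple := by
  refine Γ.isConservative_zeta.isSimple fun S hS h hh => ?_
  rw [colligation_zeta] at hS
  ext n
  refine WithLp.ofLp_injective 2 (Prod.ext ((fst_eq_zero_of_isHidden n Γ).1 S hS h hh) ?_)
  obtain ⟨k, rfl⟩ := (isHidden_opU hS).1 h hh
  exact (fst_eq_zero_of_isHidden n Γ.tail).2 _ (isHidden_opU hS).2 k hh

theorem isSimple_zetaT : Γ.zetaT.IsSimple := by
  refine Γ.isConservative_zetaT.isSimple fun S hS g hg => ?_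
  rw [colligation_zetaT] at hS
  ext n
  refine WithLp.ofLp_injective 2 (Prod.ext ((fst_eq_zero_of_isHidden n Γ).2 S hS g hg) ?_)
  obtain ⟨k, rfl⟩ := (isHidden_opUT hS).1 g hg
  exact (fst_eq_zero_of_isHidden n Γ.tail).1 _ (isHidden_opUT hS).2 k hg

/-! ### Schur parameters -/

theorem zeta_D : Γ.zeta.D = Γ.op 0 := by
  ext x
  change (Γ.opU (WithLp.toLp 2 (x, 0))).fst = _
  rw [← map_zero Γ.glue, opU_glue, map_zero]
  exact (congrArg (Γ.op 0 x + ·) (map_zero (Γ.defY 0))).trans (add_zero _)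

theorem norm_adj_le (n : ℕ) : ‖Γ.adj n‖ ≤ 1 := by
  refine ContinuousLinearMap.opNorm_le_bound _ zero_le_one fun y => ?_
  rw [← (Γ.inclX n).norm_map, inclX_adj, ← (Γ.inclY n).norm_map y]
  exact (adjoint (Γ.op n)).le_of_opNorm_le (Γ.norm_adjoint_op_le n) _

/-- The Möbius representation of the transfer function of `ζ_0`, whose Möbius parameter is
`z ↦ z Θ_1(z)` with `Θ_1` the transfer function of the shifted choice sequence. -/
theorem transfer_zeta_eq_moebius {z : ℂ} (hz : z ∈ Metric.ball (0 : ℂ) 1) :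
    Γ.zeta.transfer z = Γ.op 0 + Γ.defY 0 ∘L (z • Γ.tail.zeta.transfer z) ∘L
      Ring.inverse (1 + Γ.adj 0 ∘L (z • Γ.tail.zeta.transfer z)) ∘L Γ.defX 0 := by
  have hu : IsUnit (1 + Γ.adj 0 ∘L (z • Γ.tail.zeta.transfer z)) := by
    rw [← sub_neg_eq_add]
    refine isUnit_one_sub_of_norm_lt_one ?_
    rw [norm_neg]
    have h1 := Γ.tail.isConservative_zeta.schurClass_transfer.2 z hz
    rw [mem_ball_zero_iff] at hz
    have h2 : ‖z • Γ.tail.zeta.transfer z‖ ≤ ‖z‖ := by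
      rw [norm_smul]
      exact mul_le_of_le_one_right (norm_nonneg _) h1
    refine (ContinuousLinearMap.opNorm_comp_le _ _).trans_lt ?_
    exact (mul_le_of_le_one_left (norm_nonneg _) (Γ.norm_adj_le 0)).trans_lt (h2.trans_lt hz)
  ext x
  -- `z ξ` is the input that the system of the shifted sequence receives from `J_{Γ_0}`
  set ξ : X 1 := Ring.inverse (1 + Γ.adj 0 ∘L (z • Γ.tail.zeta.transfer z)) (Γ.defX 0 x) with hξ
  have h1 : ξ + Γ.adj 0 (z • Γ.tail.zeta.transfer z ξ) = Γ.defX 0 x :=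
    DFunLike.congr_fun (Ring.mul_inverse_cancel _ hu) (Γ.defX 0 x)
  have hb := LinSys.isUnit_one_sub_smul Γ.tail.isConservative_zetaT.norm_A_le hz
  obtain ⟨k, hk⟩ := LinSys.exists_colligation_eq_transfer hb (z • ξ)
  rw [colligation_zetaT, ← Γ.tail.transfer_zeta_eq hz, map_smul] at hk
  refine LinSys.transfer_eq_of_colligation_eq
    (LinSys.isUnit_one_sub_smul Γ.isConservative_zeta.norm_A_le hz)
    (g := Γ.glue (WithLp.toLp 2 (ξ, k))) ?_
  rw [colligation_zeta, ← map_smul]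
  refine (Γ.opU_glue x (WithLp.toLp 2 (z • ξ, z • k))).trans ?_
  have hk1 : (Γ.tail.opUT (WithLp.toLp 2 (z • ξ, z • k))).fst = z • Γ.tail.zeta.transfer z ξ :=
    congrArg WithLp.fst hk
  have hk2 : (Γ.tail.opUT (WithLp.toLp 2 (z • ξ, z • k))).snd = k := congrArg WithLp.snd hk
  rw [hk1, hk2, ← h1, add_sub_cancel_right]
  rfl

end ChoiceSequence

/-- The Schur iterates of the transfer function of `ζ_0`: the transfer functions of the systems
`ζ_0({Γ_{n+k}}_{k ≥ 0})`. -/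
def ChoiceSequence.schurIterate : ∀ (n : ℕ) {X Y : ℕ → Type*}
    [∀ n, NormedAddCommGroup (X n)] [∀ n, InnerProductSpace ℂ (X n)] [∀ n, CompleteSpace (X n)]
    [∀ n, NormedAddCommGroup (Y n)] [∀ n, InnerProductSpace ℂ (Y n)] [∀ n, CompleteSpace (Y n)]
    (_ : ChoiceSequence X Y), ℂ → X n →L[ℂ] Y n
  | 0, _, _, _, _, _, _, _, _, Γ => Γ.zeta.transfer
  | n + 1, _, _, _, _, _, _, _, _, Γ => schurIterate n Γ.tail

theorem ChoiceSequence.schurIterate_spec (n : ℕ) : ∀ {X Y : ℕ → Type*}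
    [∀ n, NormedAddCommGroup (X n)] [∀ n, InnerProductSpace ℂ (X n)] [∀ n, CompleteSpace (X n)]
    [∀ n, NormedAddCommGroup (Y n)] [∀ n, InnerProductSpace ℂ (Y n)] [∀ n, CompleteSpace (Y n)]
    (Γ : ChoiceSequence X Y),
    SchurClass (Γ.schurIterate n) ∧ Γ.schurIterate n 0 = Γ.op n ∧
      ∀ z ∈ Metric.ball (0 : ℂ) 1,
        Γ.schurIterate n z = Γ.op n + Γ.defY n ∘L (z • Γ.schurIterate (n + 1) z) ∘L
          Ring.inverse (1 + Γ.adj n ∘L (z • Γ.schurIterate (n + 1) z)) ∘L Γ.defX n := by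
  induction n with
  | zero =>
    intro X Y _ _ _ _ _ _ Γ
    refine ⟨Γ.isConservative_zeta.schurClass_transfer,
      (LinSys.transfer_zero _).trans Γ.zeta_D, fun z hz => ?_⟩
    have h1 : Γ.schurIterate (0 + 1) z = Γ.tail.zeta.transfer z := rfl
    have h0 : Γ.schurIterate 0 z = Γ.zeta.transfer z := rfl
    rw [h0, h1]
    exact Γ.transfer_zeta_eq_moebius hz
  | succ n ih =>
    intro X Y _ _ _ _ _ _ Γ
    exact ih Γ.tail

theorem ChoiceSequence.isSchurParametersOf_of_eq {X Y : ℕ → Type*}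
    [∀ n, NormedAddCommGroup (X n)] [∀ n, InnerProductSpace ℂ (X n)] [∀ n, CompleteSpace (X n)]
    [∀ n, NormedAddCommGroup (Y n)] [∀ n, InnerProductSpace ℂ (Y n)] [∀ n, CompleteSpace (Y n)]
    (Γ : ChoiceSequence X Y) {Θ : ℂ → X 0 →L[ℂ] Y 0}
    (h : ∀ z ∈ Metric.ball (0 : ℂ) 1, Γ.zeta.transfer z = Θ z) : Γ.IsSchurParametersOf Θ :=
  ⟨fun n => Γ.schurIterate n, h, fun n => Γ.schurIterate_spec n⟩

namespace ChoiceSequence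

variable {X Y : ℕ → Type*}
  [∀ n, NormedAddCommGroup (X n)] [∀ n, InnerProductSpace ℂ (X n)] [∀ n, CompleteSpace (X n)]
  [∀ n, NormedAddCommGroup (Y n)] [∀ n, InnerProductSpace ℂ (Y n)] [∀ n, CompleteSpace (Y n)]
  (Γ : ChoiceSequence X Y)

/-! ### The blocks of the two systems -/

theorem zetaT_D : Γ.zetaT.D = Γ.op 0 := by
  obtain ⟨w, hD, -⟩ := Γ.unitarilyEquivalent_zeta_zetaT
  rw [← zeta_D]
  ext x
  exact (hD x).symm

/-- The identification of `𝔇_{Γ_0} ⊕ ℌ̃_0({Γ_n}_{n ≥ 1})` with `ℌ̃_0` through `V_0`. -/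
def glueV : WithLp 2 (X 1 × Γ.tail.StateSpaceT) ≃ₗᵢ[ℂ] Γ.StateSpaceT :=
  Γ.glue.trans Γ.unitaryV

/-- The identification of `𝔇_{Γ_0^*} ⊕ ℌ_0({Γ_n}_{n ≥ 1})` with `ℌ_0` through `V_0`. -/
def glueTV : WithLp 2 (Y 1 × Γ.tail.StateSpace) ≃ₗᵢ[ℂ] Γ.StateSpace :=
  Γ.glueT.trans Γ.unitaryV.symm

theorem glueV_apply (v : WithLp 2 (X 1 × Γ.tail.StateSpaceT)) :
    Γ.glueV v = Γ.glueT (Γ.tail.opL v) := by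
  rw [← opV_glue, opV_eq]
  rfl

theorem glue_eq_glueTV (v : WithLp 2 (X 1 × Γ.tail.StateSpaceT)) :
    Γ.glue v = Γ.glueTV (Γ.tail.opL v) := by
  apply Γ.unitaryV.injective
  rw [← opV_eq, opV_glue]
  exact (Γ.unitaryV.apply_symm_apply _).symm

theorem opV_glueTV (v : WithLp 2 (Y 1 × Γ.tail.StateSpace)) :
    Γ.opV (Γ.glueTV v) = Γ.glueT v := by
  rw [opV_eq]
  exact Γ.unitaryV.apply_symm_apply _

/-- The factorization `B = W D_{Γ_0}` for `ζ_0`, with `W` the embedding of `𝔇_{Γ_0}` into `ℌ_0` as the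
first component. -/
theorem zeta_B_apply (x : X 0) (ξ : X 1) (h : Γ.inclX 0 ξ = defectOp (Γ.op 0) x) :
    Γ.zeta.B x = inlIsometry Γ.glue ξ := by
  rw [← inclX_defX] at h
  rw [(Γ.inclX 0).injective h]
  change (Γ.opU (WithLp.toLp 2 (x, 0))).snd = Γ.glue (WithLp.toLp 2 (Γ.defX 0 x, 0))
  rw [← map_zero Γ.glue, opU_glue, map_zero Γ.tail.opUT]
  refine congrArg (fun y => Γ.glue (WithLp.toLp 2 (y, 0))) ?_
  exact (congrArg (Γ.defX 0 x - ·) (map_zero (Γ.adj 0))).trans (sub_zero _)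

/-- The factorization `B = W D_{Γ_0}` for `ζ̃_0`, with `W` the embedding of `𝔇_{Γ_0}` into `ℌ_0`
followed by `V_0`. -/
theorem zetaT_B_apply (x : X 0) (ξ : X 1) (h : Γ.inclX 0 ξ = defectOp (Γ.op 0) x) :
    Γ.zetaT.B x = inlIsometry Γ.glueV ξ := by
  have h1 : Γ.zetaT.B x = Γ.opV (Γ.zeta.B x) := by
    have h2 := Γ.opUT_opV x 0
    rw [map_zero] at h2
    exact congrArg WithLp.snd h2
  rw [h1, zeta_B_apply Γ x ξ h, opV_eq]
  rfl

/-- The map `f ↦ (V_0 f)_0` onto the component in `𝔇_{Γ_0^*}`, through which `C` factors. -/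
def outZeta : Γ.StateSpace →L[ℂ] Y 1 :=
  WithLp.fstL 2 ℂ (Y 1) Γ.tail.StateSpace ∘L
    Γ.glueTV.symm.toContinuousLinearEquiv.toContinuousLinearMap

/-- The component of a vector of `ℌ̃_0` in `𝔇_{Γ_0^*}`, through which `C` factors. -/
def outZetaT : Γ.StateSpaceT →L[ℂ] Y 1 :=
  WithLp.fstL 2 ℂ (Y 1) Γ.tail.StateSpace ∘L
    Γ.glueT.symm.toContinuousLinearEquiv.toContinuousLinearMap

theorem outZeta_apply (f : Γ.StateSpace) : Γ.outZeta f = (Γ.glueTV.symm f).fst := rfl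

theorem outZetaT_apply (g : Γ.StateSpaceT) : Γ.outZetaT g = (Γ.glueT.symm g).fst := rfl

theorem opL_glueT_zero (v : WithLp 2 (Y 1 × Γ.tail.StateSpace)) :
    Γ.opL (WithLp.toLp 2 (0, Γ.glueT v)) = WithLp.toLp 2 (Γ.defY 0 v.fst,
      Γ.glue (WithLp.toLp 2 (-Γ.adj 0 v.fst, Γ.tail.opV v.snd))) := by
  have h := Γ.opL_glueT 0 v.fst v.snd
  rw [map_zero, zero_add, map_zero, zero_sub] at h
  exact h

theorem zeta_C_glueTV (v : WithLp 2 (Y 1 × Γ.tail.StateSpace)) :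
    Γ.zeta.C (Γ.glueTV v) = Γ.defY 0 v.fst := by
  change (Γ.opU (WithLp.toLp 2 (0, Γ.glueTV v))).fst = _
  rw [opU_toLp, opV_glueTV, opL_glueT_zero]
  rfl

theorem zeta_A_glueTV (v : WithLp 2 (Y 1 × Γ.tail.StateSpace)) :
    Γ.zeta.A (Γ.glueTV v) = Γ.glue (WithLp.toLp 2 (-Γ.adj 0 v.fst, Γ.tail.opV v.snd)) := by
  change (Γ.opU (WithLp.toLp 2 (0, Γ.glueTV v))).snd = _
  rw [opU_toLp, opV_glueTV, opL_glueT_zero]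
  rfl

theorem zetaT_C_glueT (v : WithLp 2 (Y 1 × Γ.tail.StateSpace)) :
    Γ.zetaT.C (Γ.glueT v) = Γ.defY 0 v.fst := by
  change (Γ.opUT (WithLp.toLp 2 (0, Γ.glueT v))).fst = _
  rw [opUT_eq, opL_glueT_zero]
  rfl

theorem zetaT_A_glueT (v : WithLp 2 (Y 1 × Γ.tail.StateSpace)) :
    Γ.zetaT.A (Γ.glueT v) =
      Γ.glueV (WithLp.toLp 2 (-Γ.adj 0 v.fst, Γ.tail.opV v.snd)) := by
  change (Γ.opUT (WithLp.toLp 2 (0, Γ.glueT v))).snd = _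
  rw [opUT_eq, opL_glueT_zero, opV_eq]
  rfl

theorem zeta_C_eq (f : Γ.StateSpace) :
    Γ.zeta.C f = defectOp (adjoint (Γ.op 0)) (Γ.inclY 0 (Γ.outZeta f)) := by
  obtain ⟨v, rfl⟩ := Γ.glueTV.surjective f
  rw [zeta_C_glueTV, outZeta_apply, LinearIsometryEquiv.symm_apply_apply]
  rfl

theorem zetaT_C_eq (g : Γ.StateSpaceT) :
    Γ.zetaT.C g = defectOp (adjoint (Γ.op 0)) (Γ.inclY 0 (Γ.outZetaT g)) := by
  obtain ⟨v, rfl⟩ := Γ.glueT.surjective g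
  rw [zetaT_C_glueT, outZetaT_apply, LinearIsometryEquiv.symm_apply_apply]
  rfl

theorem range_inclX_zeta : LinearMap.range (Γ.inclX 0).toLinearMap = defectSpace Γ.zeta.D := by
  rw [zeta_D]
  exact Γ.range_inclX 0

theorem range_inclY_zeta :
    LinearMap.range (Γ.inclY 0).toLinearMap = defectSpace (adjoint Γ.zeta.D) := by
  rw [zeta_D]
  exact Γ.range_inclY 0

theorem range_inclX_zetaT : LinearMap.range (Γ.inclX 0).toLinearMap = defectSpace Γ.zetaT.D := by
  rw [zetaT_D]
  exact Γ.range_inclX 0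

theorem range_inclY_zetaT :
    LinearMap.range (Γ.inclY 0).toLinearMap = defectSpace (adjoint Γ.zetaT.D) := by
  rw [zetaT_D]
  exact Γ.range_inclY 0

/-! ### Kernels of the defect operators -/

theorem mem_defectKer_zeta_A (f : Γ.StateSpace) :
    f ∈ defectKer Γ.zeta.A ↔ (Γ.glueTV.symm f).fst = 0 := by
  rw [Γ.isConservative_zeta.mem_defectKer_A]
  obtain ⟨v, rfl⟩ := Γ.glueTV.surjective f
  rw [zeta_C_glueTV, LinearIsometryEquiv.symm_apply_apply]
  exact ⟨Γ.eq_zero_of_defY_eq_zero, fun h => (congrArg _ h).trans (map_zero _)⟩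

theorem mem_defectKer_zetaT_A (g : Γ.StateSpaceT) :
    g ∈ defectKer Γ.zetaT.A ↔ (Γ.glueT.symm g).fst = 0 := by
  rw [Γ.isConservative_zetaT.mem_defectKer_A]
  obtain ⟨v, rfl⟩ := Γ.glueT.surjective g
  rw [zetaT_C_glueT, LinearIsometryEquiv.symm_apply_apply]
  exact ⟨Γ.eq_zero_of_defY_eq_zero, fun h => (congrArg _ h).trans (map_zero _)⟩

theorem zeta_B_eq (x : X 0) (ξ : X 1) (h : Γ.inclX 0 ξ = defectOp Γ.zeta.D x) :
    Γ.zeta.B x = inlIsometry Γ.glue ξ :=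
  Γ.zeta_B_apply x ξ (by rwa [zeta_D] at h)

theorem zetaT_B_eq (x : X 0) (ξ : X 1) (h : Γ.inclX 0 ξ = defectOp Γ.zetaT.D x) :
    Γ.zetaT.B x = inlIsometry Γ.glueV ξ :=
  Γ.zetaT_B_apply x ξ (by rwa [zetaT_D] at h)

theorem mem_defectKer_adjoint_zeta_A (f : Γ.StateSpace) :
    f ∈ defectKer (adjoint Γ.zeta.A) ↔ (Γ.glue.symm f).fst = 0 := by
  rw [Γ.isConservative_zeta.mem_defectKer_adjoint_A_iff Γ.range_inclX_zeta Γ.zeta_B_eq,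
    adjoint_inlIsometry]

theorem mem_defectKer_adjoint_zetaT_A (g : Γ.StateSpaceT) :
    g ∈ defectKer (adjoint Γ.zetaT.A) ↔ (Γ.glueV.symm g).fst = 0 := by
  rw [Γ.isConservative_zetaT.mem_defectKer_adjoint_A_iff Γ.range_inclX_zetaT Γ.zetaT_B_eq,
    adjoint_inlIsometry]

/-- The right hand side says that `v = J_{Γ_n^*} (0, φ)`. -/
theorem unitaryJ_fst_eq_zero_iff (n : ℕ) (v : WithLp 2 (X n × Y (n + 1))) :
    (Γ.unitaryJ n v).fst = 0 ↔ ∃ φ : X (n + 1), v.fst = defectOp (Γ.op n) (Γ.inclX n φ) ∧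
      Γ.inclY n v.snd = -Γ.op n (Γ.inclX n φ) := by
  have hJ : ∀ φ : X (n + 1), Γ.unitaryJ n (WithLp.toLp 2 (defectOp (Γ.op n) (Γ.inclX n φ),
      adjoint (Γ.inclY n).toContinuousLinearMap (-Γ.op n (Γ.inclX n φ)))) =
        WithLp.toLp 2 (0, φ) := by
    intro φ
    have h := Γ.J_inverse n 0 φ
    rw [map_zero, map_zero, zero_add, zero_sub] at h
    exact h
  constructor
  · intro h0
    refine ⟨(Γ.unitaryJ n v).snd, ?_⟩
    have h1 : v = _ := (Γ.unitaryJ n).injective ((show Γ.unitaryJ n v =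
      WithLp.toLp 2 (0, (Γ.unitaryJ n v).snd) from
        WithLp.ofLp_injective 2 (Prod.ext h0 rfl)).trans (hJ _).symm)
    refine ⟨congrArg WithLp.fst h1, ?_⟩
    refine (congrArg (fun w => Γ.inclY n (WithLp.snd w)) h1).trans ?_
    exact isometry_adjoint_apply (Γ.range_inclY n)
      (neg_mem (map_mem_defectSpace (Γ.norm_op_le n) (Γ.inclX_mem n _)))
  · rintro ⟨φ, h1, h2⟩
    have h3 : v = WithLp.toLp 2 (defectOp (Γ.op n) (Γ.inclX n φ),
        adjoint (Γ.inclY n).toContinuousLinearMap (-Γ.op n (Γ.inclX n φ))) := by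
      rw [← h1, ← h2, adjoint_isometry_apply]
      rfl
    rw [h3, hJ]
    rfl

/-- The right hand side says that `w = J_{Γ_n} (0, φ)`. -/
theorem unitaryJ_symm_fst_eq_zero_iff (n : ℕ) (w : WithLp 2 (Y n × X (n + 1))) :
    ((Γ.unitaryJ n).symm w).fst = 0 ↔
      ∃ φ : Y (n + 1), w.fst = defectOp (adjoint (Γ.op n)) (Γ.inclY n φ) ∧
        Γ.inclX n w.snd = -adjoint (Γ.op n) (Γ.inclY n φ) := by
  obtain ⟨v, rfl⟩ := (Γ.unitaryJ n).surjective w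
  rw [LinearIsometryEquiv.symm_apply_apply]
  have hJ : Γ.unitaryJ n v =
      WithLp.toLp 2 (Γ.op n v.fst + Γ.defY n v.snd, Γ.defX n v.fst + -Γ.adj n v.snd) := rfl
  have hJ0 : ∀ φ, Γ.unitaryJ n (WithLp.toLp 2 (0, φ)) =
      WithLp.toLp 2 (Γ.defY n φ, -Γ.adj n φ) := by
    intro φ
    change WithLp.toLp 2 (Γ.op n 0 + Γ.defY n φ, Γ.defX n 0 + -Γ.adj n φ) = _
    rw [map_zero, map_zero, zero_add, zero_add]
  constructor
  · intro h0
    refine ⟨v.snd, ?_⟩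
    rw [hJ, h0, map_zero, map_zero, zero_add, zero_add]
    refine ⟨rfl, ?_⟩
    rw [← inclX_adj]
    exact map_neg _ _
  · rintro ⟨φ, h1, h2⟩
    have h3 : Γ.unitaryJ n v = Γ.unitaryJ n (WithLp.toLp 2 (0, φ)) := by
      rw [hJ0]
      refine WithLp.ofLp_injective 2 (Prod.ext h1 ((Γ.inclX n).injective (h2.trans ?_)))
      rw [← inclX_adj]
      exact (map_neg _ _).symm
    rw [(Γ.unitaryJ n).injective h3]
    rfl

theorem mem_defectKer_trunc_iff (f : Γ.StateSpace) : f ∈ defectKer Γ.trunc ↔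
    ∃ φ : X 2, (f 0).fst = defectOp (Γ.op 1) (Γ.inclX 1 φ) ∧
      Γ.inclY 1 (f 0).snd = -Γ.op 1 (Γ.inclX 1 φ) :=
  (Γ.mem_defectKer_zeta_A f).trans (Γ.unitaryJ_fst_eq_zero_iff 1 (f 0))

theorem mem_defectKer_adjoint_truncT_iff (g : Γ.StateSpaceT) :
    g ∈ defectKer (adjoint Γ.truncT) ↔
      ∃ φ : Y 2, (g 0).fst = defectOp (adjoint (Γ.op 1)) (Γ.inclY 1 φ) ∧
        Γ.inclX 1 (g 0).snd = -adjoint (Γ.op 1) (Γ.inclY 1 φ) :=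
  (Γ.mem_defectKer_adjoint_zetaT_A g).trans (Γ.unitaryJ_symm_fst_eq_zero_iff 1 (g 0))

/-! ### The transformations `Ω_{0,1}` and `Ω_{1,0}` -/

theorem opUT_fst (v : WithLp 2 (X 0 × Γ.StateSpaceT)) : (Γ.opUT v).fst = (Γ.opL v).fst := by
  rw [opUT_eq]
  rfl

theorem opUT_snd (v : WithLp 2 (X 0 × Γ.StateSpaceT)) :
    (Γ.opUT v).snd = Γ.opV (Γ.opL v).snd := by
  rw [opUT_eq]
  rfl

theorem outZeta_glue (v : WithLp 2 (X 1 × Γ.tail.StateSpaceT)) :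
    Γ.outZeta (Γ.glue v) = (Γ.tail.opUT v).fst := by
  rw [outZeta_apply, glue_eq_glueTV, LinearIsometryEquiv.symm_apply_apply]
  exact (Γ.tail.opUT_fst v).symm

theorem zeta_A_glue (v : WithLp 2 (X 1 × Γ.tail.StateSpaceT)) :
    Γ.zeta.A (Γ.glue v) = Γ.glue (WithLp.toLp 2 (-Γ.adj 0 (Γ.tail.opL v).fst,
      (Γ.tail.opUT v).snd)) := by
  rw [glue_eq_glueTV, zeta_A_glueTV]
  refine congrArg (fun k => Γ.glue (WithLp.toLp 2 (_, k))) ?_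
  exact (Γ.tail.opUT_snd v).symm

theorem zetaT_A_glueT_zero (h : Γ.tail.StateSpace) :
    Γ.zetaT.A (Γ.glueT (WithLp.toLp 2 (0, h))) =
      Γ.glueT (Γ.tail.opU (WithLp.toLp 2 (0, h))) := by
  rw [zetaT_A_glueT, glueV_apply]
  refine congrArg Γ.glueT (Eq.trans ?_ (Γ.tail.opU_toLp 0 h).symm)
  refine congrArg (fun y => Γ.tail.opL (WithLp.toLp 2 (y, Γ.tail.opV h))) ?_
  exact (congrArg (- ·) (map_zero (Γ.adj 0))).trans neg_zero

/-- `Ω_{0,1}(ζ_0)` is `ζ̃_0` for the shifted sequence. The projections onto `ker D_A` and `ker D_{A^*}`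
drop the first component with respect to `glueTV` and `glue`. -/
theorem tail_intertwines_omega01 :
    Γ.tail.zetaT.Intertwines Γ.zeta.omega01 (rangeEquiv _ Γ.range_inclX_zeta)
      (rangeEquiv _ Γ.range_inclY_zeta)
      (rangeEquiv _ (range_inrIsometry _ Γ.mem_defectKer_adjoint_zeta_A)) := by
  have hC : ∀ f, defectInvComp (adjoint Γ.zeta.D) Γ.zeta.C f =
      rangeEquiv _ Γ.range_inclY_zeta (Γ.outZeta f) :=
    defectInvComp_C Γ.range_inclY_zeta fun f => by rw [zeta_C_eq, zeta_D]
  refine ⟨fun x => ?_, fun k => ?_, fun x => ?_, fun k => ?_⟩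
  · change _ = defectInvComp (adjoint Γ.zeta.D) Γ.zeta.C
      (adjoint (defectInvComp Γ.zeta.D (adjoint Γ.zeta.B)) (rangeEquiv _ Γ.range_inclX_zeta x))
    rw [adjoint_defectInvComp_B Γ.range_inclX_zeta Γ.zeta_B_eq, hC, inlIsometry_apply,
      outZeta_glue]
    rfl
  · change _ = defectInvComp (adjoint Γ.zeta.D) Γ.zeta.C (Γ.glue (WithLp.toLp 2 (0, k)))
    rw [hC, outZeta_glue]
    rfl
  · refine Subtype.ext ?_
    change Γ.glue (WithLp.toLp 2 (0, (Γ.tail.opUT (WithLp.toLp 2 (x, 0))).snd)) =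
      ((defectKer (adjoint Γ.zeta.A)).orthogonalProjectionOnto (Γ.zeta.A
        ((defectKer Γ.zeta.A).orthogonalProjectionOnto
          (defectInvComp (adjoint Γ.zeta.A) Γ.zeta.B (Γ.inclX 0 x) : Γ.StateSpace) :
            Γ.StateSpace)) : Γ.StateSpace)
    rw [defectInvComp_B Γ.isConservative_zeta Γ.range_inclX_zeta Γ.zeta_B_eq, inlIsometry_apply,
      glue_eq_glueTV _ (WithLp.toLp 2 (x, 0)), projection_apply _ Γ.mem_defectKer_zeta_A,
      zeta_A_glueTV, projection_apply _ Γ.mem_defectKer_adjoint_zeta_A]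
    refine congrArg (fun k => Γ.glue (WithLp.toLp 2 (0, k))) ?_
    exact Γ.tail.opUT_snd _
  · refine Subtype.ext ?_
    change Γ.glue (WithLp.toLp 2 (0, (Γ.tail.opUT (WithLp.toLp 2 (0, k))).snd)) =
      ((defectKer (adjoint Γ.zeta.A)).orthogonalProjectionOnto
        (Γ.zeta.A (Γ.glue (WithLp.toLp 2 (0, k)))) : Γ.StateSpace)
    rw [zeta_A_glue, projection_apply _ Γ.mem_defectKer_adjoint_zeta_A]
    rfl

/-- `Ω_{1,0}(ζ̃_0)` is `ζ_0` for the shifted sequence. The projection onto `ker D_A` drops the first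
component with respect to `glueT`. -/
theorem tail_intertwines_omega10 :
    Γ.tail.zeta.Intertwines Γ.zetaT.omega10 (rangeEquiv _ Γ.range_inclX_zetaT)
      (rangeEquiv _ Γ.range_inclY_zetaT)
      (rangeEquiv _ (range_inrIsometry _ Γ.mem_defectKer_zetaT_A)) := by
  have hC : ∀ g, defectInvComp (adjoint Γ.zetaT.D) Γ.zetaT.C g =
      rangeEquiv _ Γ.range_inclY_zetaT (Γ.outZetaT g) :=
    defectInvComp_C Γ.range_inclY_zetaT fun g => by rw [zetaT_C_eq, zetaT_D]
  have hU : ∀ x, Γ.tail.opU (WithLp.toLp 2 (x, 0)) = Γ.tail.opL (WithLp.toLp 2 (x, 0)) := by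
    intro x
    rw [opU_toLp, map_zero]
  refine ⟨fun x => ?_, fun h => ?_, fun x => ?_, fun h => ?_⟩
  · change rangeEquiv _ Γ.range_inclY_zetaT (Γ.tail.opU (WithLp.toLp 2 (x, 0))).fst =
      defectInvComp (adjoint Γ.zetaT.D) Γ.zetaT.C
      (adjoint (defectInvComp Γ.zetaT.D (adjoint Γ.zetaT.B)) (rangeEquiv _ Γ.range_inclX_zetaT x))
    rw [adjoint_defectInvComp_B Γ.range_inclX_zetaT Γ.zetaT_B_eq, hC, inlIsometry_apply,
      glueV_apply, outZetaT_apply, LinearIsometryEquiv.symm_apply_apply, hU]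
  · change rangeEquiv _ Γ.range_inclY_zetaT (Γ.tail.opU (WithLp.toLp 2 (0, h))).fst =
      defectInvComp (adjoint Γ.zetaT.D) Γ.zetaT.C (Γ.zetaT.A (Γ.glueT (WithLp.toLp 2 (0, h))))
    rw [hC, zetaT_A_glueT_zero, outZetaT_apply, LinearIsometryEquiv.symm_apply_apply]
  · refine Subtype.ext ?_
    change Γ.glueT (WithLp.toLp 2 (0, (Γ.tail.opU (WithLp.toLp 2 (x, 0))).snd)) =
      ((defectKer Γ.zetaT.A).orthogonalProjectionOnto
        (defectInvComp (adjoint Γ.zetaT.A) Γ.zetaT.B (Γ.inclX 0 x) : Γ.StateSpaceT) :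
          Γ.StateSpaceT)
    rw [defectInvComp_B Γ.isConservative_zetaT Γ.range_inclX_zetaT Γ.zetaT_B_eq,
      inlIsometry_apply, glueV_apply, projection_apply _ Γ.mem_defectKer_zetaT_A, hU]
  · refine Subtype.ext ?_
    change Γ.glueT (WithLp.toLp 2 (0, (Γ.tail.opU (WithLp.toLp 2 (0, h))).snd)) =
      ((defectKer Γ.zetaT.A).orthogonalProjectionOnto
        (Γ.zetaT.A (Γ.glueT (WithLp.toLp 2 (0, h)))) : Γ.StateSpaceT)
    rw [zetaT_A_glueT_zero, projection_apply _ Γ.mem_defectKer_zetaT_A]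

end ChoiceSequence

end CMV

end

theorem theorem5p2 {X Y : ℕ → Type*}
    [∀ n, NormedAddCommGroup (X n)] [∀ n, InnerProductSpace ℂ (X n)] [∀ n, CompleteSpace (X n)]
    [∀ n, NormedAddCommGroup (Y n)] [∀ n, InnerProductSpace ℂ (Y n)] [∀ n, CompleteSpace (Y n)]
    (Γ : CMV.ChoiceSequence X Y) :
    -- the systems are conservative, unitarily equivalent and simple
    Γ.zeta.IsConservative ∧ Γ.zetaT.IsConservative ∧
    Γ.zeta.UnitarilyEquivalent Γ.zetaT ∧
    Γ.zeta.IsSimple ∧ Γ.zetaT.IsSimple ∧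
    -- they have the same transfer function, which is a Schur class function with
    -- Schur parameters `Γ`
    (∀ z ∈ Metric.ball (0 : ℂ) 1, Γ.zeta.transfer z = Γ.zetaT.transfer z) ∧
    CMV.SchurClass Γ.zeta.transfer ∧ Γ.IsSchurParametersOf Γ.zeta.transfer ∧
    CMV.SchurClass Γ.zetaT.transfer ∧ Γ.IsSchurParametersOf Γ.zetaT.transfer ∧
    -- the kernels of the defect operators of the truncated CMV matrices and their adjoints
    (∀ f : Γ.StateSpace, f ∈ CMV.defectKer Γ.trunc ↔
      ∃ φ : X 2, (f 0).fst = CMV.defectOp (Γ.op 1) (Γ.inclX 1 φ) ∧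
        Γ.inclY 1 (f 0).snd = -Γ.op 1 (Γ.inclX 1 φ)) ∧
    (∀ f : Γ.StateSpace, f ∈ CMV.defectKer (adjoint Γ.trunc) ↔ (f 0).fst = 0) ∧
    (∀ f : Γ.StateSpaceT, f ∈ CMV.defectKer Γ.truncT ↔ (f 0).fst = 0) ∧
    (∀ f : Γ.StateSpaceT, f ∈ CMV.defectKer (adjoint Γ.truncT) ↔
      ∃ φ : Y 2, (f 0).fst = CMV.defectOp (adjoint (Γ.op 1)) (Γ.inclY 1 φ) ∧
        Γ.inclX 1 (f 0).snd = -adjoint (Γ.op 1) (Γ.inclY 1 φ)) ∧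
    -- `Ω_{0,1}(ζ_0)` is the system of `Ũ_0({Γ_n}_{n ≥ 1})`, under the canonical identifications
    (∃ (u : X 1 ≃ₗᵢ[ℂ] CMV.defectSpace Γ.zeta.D)
        (v : Y 1 ≃ₗᵢ[ℂ] CMV.defectSpace (adjoint Γ.zeta.D))
        (w : Γ.tail.StateSpaceT ≃ₗᵢ[ℂ] CMV.defectKer (adjoint Γ.zeta.A)),
      (∀ x, (u x : X 0) = Γ.inclX 0 x) ∧ (∀ y, (v y : Y 0) = Γ.inclY 0 y) ∧
      (∀ f : Γ.tail.StateSpaceT, ((w f : Γ.StateSpace) 0).fst = 0 ∧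
        ∀ n, ((w f : Γ.StateSpace) n).snd = (f n).fst ∧
          ((w f : Γ.StateSpace) (n + 1)).fst = (f n).snd) ∧
      Γ.tail.zetaT.Intertwines Γ.zeta.omega01 u v w) ∧
    -- `Ω_{1,0}(ζ̃_0)` is the system of `U_0({Γ_n}_{n ≥ 1})`, under the canonical identifications
    (∃ (u : X 1 ≃ₗᵢ[ℂ] CMV.defectSpace Γ.zetaT.D)
        (v : Y 1 ≃ₗᵢ[ℂ] CMV.defectSpace (adjoint Γ.zetaT.D))
        (w : Γ.tail.StateSpace ≃ₗᵢ[ℂ] CMV.defectKer Γ.zetaT.A),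
      (∀ x, (u x : X 0) = Γ.inclX 0 x) ∧ (∀ y, (v y : Y 0) = Γ.inclY 0 y) ∧
      (∀ f : Γ.tail.StateSpace, ((w f : Γ.StateSpaceT) 0).fst = 0 ∧
        ∀ n, ((w f : Γ.StateSpaceT) n).snd = (f n).fst ∧
          ((w f : Γ.StateSpaceT) (n + 1)).fst = (f n).snd) ∧
      Γ.tail.zeta.Intertwines Γ.zetaT.omega10 u v w) :=
  ⟨Γ.isConservative_zeta, Γ.isConservative_zetaT, Γ.unitarilyEquivalent_zeta_zetaT,
    Γ.isSimple_zeta, Γ.isSimple_zetaT, fun _ hz => Γ.transfer_zeta_eq hz,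
    Γ.isConservative_zeta.schurClass_transfer, Γ.isSchurParametersOf_of_eq fun _ _ => rfl,
    Γ.isConservative_zetaT.schurClass_transfer,
    Γ.isSchurParametersOf_of_eq fun _ hz => Γ.transfer_zeta_eq hz,
    Γ.mem_defectKer_trunc_iff, Γ.mem_defectKer_adjoint_zeta_A, Γ.mem_defectKer_zetaT_A,
    Γ.mem_defectKer_adjoint_truncT_iff,
    ⟨_, _, _, fun _ => rfl, fun _ => rfl, fun _ => ⟨rfl, fun _ => ⟨rfl, rfl⟩⟩,
      Γ.tail_intertwines_omega01⟩,
    ⟨_, _, _, fun _ => rfl, fun _ => rfl, fun _ => ⟨rfl, fun _ => ⟨rfl, rfl⟩⟩,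
      Γ.tail_intertwines_omega10⟩⟩
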